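/- Let $\mathcal{T}$ be a finite set, $d\in\mathbb{N}$, let $(X,Y)$ be a random pair with values in $\mathcal{X}\times\mathbb{R}$, and let $\phi_t:\mathcal{X}\to\mathbb{R}^d$ ($t\in\mathcal{T}$) be feature maps such that, for each $t$, the distribution of $\phi_t(X)$ is not supported in any hyperplane through the origin. Put $\ell(\hat y,y)=(\hat y-y)^2/2$, $$R(t,w)=\mathbb{E}[\ell(\langle w,\phi_t(X)\rangle,Y)],\qquad R_*=\inf_{(t,w)\in\mathcal{T}\times\mathbb{R}^d}R(t,w),\qquad \mathcal{E}(t,w)=R(t,w)-R_*,$$ $$w_*(t)=\operatorname*{argmin}_{w\in\mathbb{R}^d}R(t,w),\qquad \mathcal{T}_*=\operatorname*{argmin}_{t\in\mathcal{T}}R(t,w_*(t)),\qquad \Sigma(t)=\mathbb{E}[\phi_t(X)\phi_t(X)^T],$$ $$g(t,(X,Y))=\nabla_w\,\ell(\langle w,\phi_t(X)\rangle,Y)\big|_{w=w_*(t)},\qquad G(t,s)=\mathbb{E}[g(t,(X,Y))\,g(s,(X,Y))^T],$$ and $\|v\|_A^2=v^TAv$. Let $(X_i,Y_i)_{i\ge1}$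 be i.i.d. copies of $(X,Y)$, and for each $n\ge1$ let $(\hat t_n,\hat w_n)$ be (random, measurable) with, almost surely, $$(\hat t_n,\hat w_n)\in\operatorname*{argmin}_{(t,w)\in\mathcal{T}\times\mathbb{R}^d}\frac1n\sum_{i=1}^n\ell(\langle w,\phi_t(X_i)\rangle,Y_i).$$ For a real random variable $U$ let $Q_U(p)=\inf\{x\in\mathbb{R}:\mathbb{P}(U\le x)\ge p\}$. Assume that $\mathbb{E}[\phi_{t,j}^2(X)]<\infty$ for all $(t,j)\in\mathcal{T}\times[d]$, that $\mathbb{E}[Y^2]<\infty$, and that $\mathbb{E}[\|g(t,(X,Y))\|_{\Sigma^{-1}(t)}^2]<\infty$ for all $t\in\mathcal{T}$. Then $$\lim_{n\to\infty}\mathbb{P}(\hat t_n\notin\mathcal{T}_*)=0.$$ Furthermore, for any $\delta\in(0,1)$, $$\tfrac12 Q_{Z^-}(1-\delta)\le\liminf_{n\to\infty}n\,Q_{\mathcal{E}(\hat t_n,\hat w_n)}(1-\delta)\le\limsup_{n\to\infty}n\,Q_{\mathcal{E}(\hat t_n,\hat w_n)}(1-\delta)\le\tfrac12 Q_{Z^+}(1-\delta),$$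 where $Z^-=\min_{s\in\mathcal{T}_*}\|Z_s\|_2^2$, $Z^+=\max_{s\in\mathcal{T}_*}\|Z_s\|_2^2$, and the random vectors $(Z_t)_{t\in\mathcal{T}}$ are jointly Gaussian with mean zero and covariance $\mathbb{E}[Z_tZ_s^T]=\Sigma^{-1/2}(t)\,G(t,s)\,\Sigma^{-1/2}(s)$ for all $t,s\in\mathcal{T}$. In particular, if $\mathcal{T}_*=\{t_*\}$, then $$n\cdot\mathcal{E}(\hat t_n,\hat w_n)\overset{d}{\to}\tfrac12\|Z\|_2^2,\qquad Z\sim\mathcal{N}\big(0,\Sigma^{-1/2}(t_*)\,G(t_*,t_*)\,\Sigma^{-1/2}(t_*)\big).$$ -/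

import Mathlib

open MeasureTheory ProbabilityTheory Filter Topology

noncomputable section

namespace FeatureERM

/-- The square loss `ℓ(ŷ, y) = (ŷ - y)² / 2`. -/
def loss (yhat y : ℝ) : ℝ := (yhat - y) ^ 2 / 2

/-- The quantile function `Q_X(p) = inf {x ∈ ℝ | ℙ(X ≤ x) ≥ p}` of a real random variable `X`
on a probability space `(Ω, μ)`. -/
def quantile {Ω : Type*} [MeasurableSpace Ω] (μ : Measure Ω) (X : Ω → ℝ) (p : ℝ) : ℝ :=
  sInf {x : ℝ | p ≤ μ.real {ω | X ω ≤ x}}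

/-- The empirical risk `R_n(t, w) = n⁻¹ ∑_{i < n} ℓ(⟨w, φ_t(x_i)⟩, y_i)` of the predictor `(t, w)`
on the first `n` points of the data sequence `z`, with `z i = (x_i, y_i)`. -/
def empRisk {T 𝒳 : Type*} {d : ℕ} (φ : T → 𝒳 → EuclideanSpace ℝ (Fin d)) (z : ℕ → 𝒳 × ℝ)
    (n : ℕ) (t : T) (w : EuclideanSpace ℝ (Fin d)) : ℝ :=
  (n : ℝ)⁻¹ * ∑ i ∈ Finset.range n, loss (inner ℝ w (φ t (z i).1)) (z i).2

section Population

variable {T 𝒳 : Type*} [MeasurableSpace 𝒳] {d : ℕ}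
  (P : Measure (𝒳 × ℝ)) (φ : T → 𝒳 → EuclideanSpace ℝ (Fin d))

/-- The risk `R(t, w) = 𝔼[ℓ(⟨w, φ_t(X)⟩, Y)]`, where `P` is the law of `(X, Y)`. -/
def risk (t : T) (w : EuclideanSpace ℝ (Fin d)) : ℝ :=
  ∫ p, loss (inner ℝ w (φ t p.1)) p.2 ∂P

/-- The optimal risk `R_* = inf_{(t, w)} R(t, w)`. -/
def optRisk : ℝ := ⨅ q : T × EuclideanSpace ℝ (Fin d), risk P φ q.1 q.2

/-- The excess risk `ℰ(t, w) = R(t, w) - R_*`. -/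
def excessRisk (t : T) (w : EuclideanSpace ℝ (Fin d)) : ℝ := risk P φ t w - optRisk P φ

/-- `w_*(t) = argmin_w R(t, w)`. -/
def wStar (t : T) : EuclideanSpace ℝ (Fin d) :=
  Classical.epsilon fun w => ∀ w', risk P φ t w ≤ risk P φ t w'

/-- `𝒯_* = argmin_t R(t, w_*(t))`, as a set. -/
def tStar : Set T := {t | ∀ s, risk P φ t (wStar P φ t) ≤ risk P φ s (wStar P φ s)}

/-- The population covariance matrix `Σ(t) = 𝔼[φ_t(X) φ_t(X)ᵀ]`. -/
def covMat (t : T) : Matrix (Fin d) (Fin d) ℝ :=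
  Matrix.of fun i j => ∫ p, φ t p.1 i * φ t p.1 j ∂P

section
open scoped MatrixOrder

/-- `Σ(t)^{-1/2}`, the inverse of the positive semidefinite square root of `Σ(t)`. -/
def covInvSqrt (t : T) : Matrix (Fin d) (Fin d) ℝ := (CFC.sqrt (covMat P φ t))⁻¹

end

/-- `g(t, (x, y))`, the gradient of `w ↦ ℓ(⟨w, φ_t(x)⟩, y)` at `w_*(t)`. -/
def lossGrad (t : T) (p : 𝒳 × ℝ) : EuclideanSpace ℝ (Fin d) :=
  gradient (fun w => loss (inner ℝ w (φ t p.1)) p.2) (wStar P φ t)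

/-- `‖g(t, (x, y))‖²` in the norm induced by `Σ(t)⁻¹`, where `‖v‖_A² = vᵀ A v`. -/
def lossGradSqNorm (t : T) (p : 𝒳 × ℝ) : ℝ :=
  (lossGrad P φ t p).ofLp ⬝ᵥ ((covMat P φ t)⁻¹.mulVec (lossGrad P φ t p).ofLp)

/-- `G(t, s) = 𝔼[g(t, (X, Y)) g(s, (X, Y))ᵀ]`. -/
def gradCov (t s : T) : Matrix (Fin d) (Fin d) ℝ :=
  Matrix.of fun i j => ∫ p, lossGrad P φ t p i * lossGrad P φ s p j ∂P

/-- `Σ(t)^{-1/2} G(t, s) Σ(s)^{-1/2}`. -/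
def limitCov (t s : T) : Matrix (Fin d) (Fin d) ℝ :=
  covInvSqrt P φ t * gradCov P φ t s * covInvSqrt P φ s

/-- The covariance matrix of the family `(Z_t)_t` seen as one vector with coordinates indexed by
`𝒯 × [d]`: its `(t, s)` block is `Σ(t)^{-1/2} G(t, s) Σ(s)^{-1/2}`. -/
def jointLimitCov : Matrix (T × Fin d) (T × Fin d) ℝ :=
  Matrix.of fun a b => limitCov P φ a.1 b.1 a.2 b.2

end Population

end FeatureERM

end

open FeatureERM

/-! ### Eventual events, quantiles and convergence in distribution -/

/-! For fixed `t`, both the risk and the empirical risk are exactly quadratic in `w`. Around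
`w_*(t)` the risk has no linear term and Hessian `Σ(t)`, which is positive definite by the
hyperplane assumption. The empirical risk has as gradient there the sample mean of the centred
vectors `g(t, ·)`, and as Hessian the empirical covariance `Σ_n(t)`. No remainder terms arise.

The strong law gives almost sure convergence of the empirical risk at `w_*(t)`, of its gradient (to
0) and of `Σ_n(t)`. So eventually `Σ_n(t)` is invertible, and the least empirical risk with features
`t` tends to `R(t, w_*(t))`. Since `𝒯` is finite, suboptimal `t` are eventually never selected
(`eventually_mem_tStar_and_eq`). From then on `n ℰ = ½ ‖C Σ_n⁻¹ C S_n‖²`, with `C = Σ^{1/2}` and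
`S_n` the normalized sum of whitened gradients, all at the selected `t`
(`ae_eventually_nat_mul_excessRisk_eq`). This lies between half the minimum and half the maximum of
the same expression over `𝒯_*`.

The joint central limit theorem for `(S_n(t))_t`, with `C Σ_n⁻¹ C → 1` and Slutsky
(`tendstoInDistribution_whitenedSum_comp`), gives the limits in law of these two bounds. If `𝒯_*` is
a singleton the bounds agree, whence the last claim.

Passing to quantiles from below needs only the portmanteau theorem. From above, the limiting
distribution function must not be flat at level `1 - δ`. This holds because the maximum is a
continuous, nonnegative, 2-homogeneous function of a Gaussian vector
(`lt_measureReal_lt_of_quantile_lt_of_homogeneous`). -/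

theorem tendsto_measure_compl_of_ae_eventually_mem {Ω : Type*} [MeasurableSpace Ω]
    {μ : Measure Ω} [IsFiniteMeasure μ] {s : ℕ → Set Ω} (hs : ∀ n, NullMeasurableSet (s n) μ)
    (h : ∀ᵐ ω ∂μ, ∀ᶠ n in atTop, ω ∈ s n) :
    Tendsto (fun n => μ (s n)ᶜ) atTop (𝓝 0) := by
  -- Continuity from above along the tails; their intersection is the limsup of the bad events,
  -- which is null.
  have h1 : Tendsto (fun n => μ (⋃ m ≥ n, (s m)ᶜ)) atTop (𝓝 (μ (⋂ n, ⋃ m ≥ n, (s m)ᶜ))) := by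
    refine tendsto_measure_iInter_atTop (fun n => ?_) (fun a b hab => ?_) ⟨0, measure_ne_top _ _⟩
    · exact .iUnion fun m => .iUnion fun _ => (hs m).compl
    · intro ω hω
      simp only [Set.mem_iUnion] at hω ⊢
      obtain ⟨m, hm, hω⟩ := hω
      exact ⟨m, le_trans hab hm, hω⟩
  have h2 : μ (⋂ n, ⋃ m ≥ n, (s m)ᶜ) = 0 := by
    refine measure_mono_null (fun ω hω => ?_) h
    simp only [Set.mem_iInter, Set.mem_iUnion] at hω
    simp only [Set.mem_compl_iff, Set.mem_ofPred_eq, eventually_atTop, not_exists, not_forall]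
    intro n
    obtain ⟨m, hm, hω⟩ := hω n
    exact ⟨m, hm, hω⟩
  rw [h2] at h1
  refine tendsto_of_tendsto_of_tendsto_of_le_of_le tendsto_const_nhds h1 (fun _ => bot_le) ?_
  intro n
  exact measure_mono (Set.subset_biUnion_of_mem (u := fun m => (s m)ᶜ) (le_refl n))

theorem tendsto_measureReal_compl_of_ae_eventually_mem {Ω : Type*} [MeasurableSpace Ω]
    {μ : Measure Ω} [IsFiniteMeasure μ] {s : ℕ → Set Ω} (hs : ∀ n, NullMeasurableSet (s n) μ)
    (h : ∀ᵐ ω ∂μ, ∀ᶠ n in atTop, ω ∈ s n) :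
    Tendsto (fun n => μ.real (s n)ᶜ) atTop (𝓝 0) :=
  (ENNReal.tendsto_toReal ENNReal.zero_ne_top).comp
    (tendsto_measure_compl_of_ae_eventually_mem hs h)

section Quantile

variable {Ω : Type*} [MeasurableSpace Ω]

/-- No condition on `p` or `X` is needed: the default value 0 of `sInf` scales as well. -/
theorem quantile_const_mul (μ : Measure Ω) (X : Ω → ℝ) (p : ℝ) {c : ℝ} (hc : 0 < c) :
    quantile μ (fun ω => c * X ω) p = c * quantile μ X p := by
  unfold quantile
  rw [← smul_eq_mul, ← Real.sInf_smul_of_nonneg hc.le]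
  congr 1
  ext x
  rw [Set.mem_smul_set_iff_inv_smul_mem₀ hc.ne']
  simp only [Set.mem_ofPred_eq, smul_eq_mul]
  have : ∀ ω, c * X ω ≤ x ↔ X ω ≤ c⁻¹ * x := fun ω => by
    rw [← div_eq_inv_mul, le_div_iff₀' hc]
  simp_rw [this]

variable {μ : Measure Ω} [IsProbabilityMeasure μ]

theorem cdf_map_eq_measureReal {X : Ω → ℝ} (hX : AEMeasurable X μ) (x : ℝ) :
    cdf (μ.map X) x = μ.real {ω | X ω ≤ x} := by
  have := Measure.isProbabilityMeasure_map hX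
  rw [cdf_eq_real, map_measureReal_apply_of_aemeasurable hX measurableSet_Iic]
  rfl

theorem quantile_set_nonempty {X : Ω → ℝ} (hX : AEMeasurable X μ) {p : ℝ} (hp : p < 1) :
    {x : ℝ | p ≤ μ.real {ω | X ω ≤ x}}.Nonempty := by
  obtain ⟨x, hx⟩ := ((tendsto_cdf_atTop (μ.map X)).eventually (lt_mem_nhds hp)).exists
  exact ⟨x, by rw [cdf_map_eq_measureReal hX] at hx; exact hx.le⟩

theorem quantile_set_bddBelow {X : Ω → ℝ} (hX : AEMeasurable X μ) {p : ℝ} (hp : 0 < p) :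
    BddBelow {x : ℝ | p ≤ μ.real {ω | X ω ≤ x}} := by
  obtain ⟨x, hx⟩ := ((tendsto_cdf_atBot (μ.map X)).eventually (gt_mem_nhds hp)).exists
  rw [cdf_map_eq_measureReal hX] at hx
  refine ⟨x, fun y hy => ?_⟩
  by_contra! hyx
  refine absurd (le_trans hy ?_) hx.not_ge
  exact measureReal_mono fun ω hω => le_trans hω hyx.le

theorem quantile_le_of_le {X : Ω → ℝ} (hX : AEMeasurable X μ) {p x : ℝ} (hp : 0 < p)
    (h : p ≤ μ.real {ω | X ω ≤ x}) : quantile μ X p ≤ x :=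
  csInf_le (quantile_set_bddBelow hX hp) h

theorem le_quantile_of_lt {X : Ω → ℝ} (hX : AEMeasurable X μ) {p x : ℝ} (hp : p < 1)
    (h : μ.real {ω | X ω ≤ x} < p) : x ≤ quantile μ X p := by
  refine le_csInf (quantile_set_nonempty hX hp) fun y hy => ?_
  by_contra! hyx
  refine absurd (le_trans hy ?_) h.not_ge
  exact measureReal_mono fun ω hω => le_trans hω hyx.le

theorem measureReal_lt_of_lt_quantile {X : Ω → ℝ} (hX : AEMeasurable X μ) {p x : ℝ} (hp : 0 < p)
    (h : x < quantile μ X p) : μ.real {ω | X ω ≤ x} < p := by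
  by_contra! h'
  exact absurd (quantile_le_of_le hX hp h') h.not_ge

variable {Ω' : Type*} [MeasurableSpace Ω'] {ν : Measure Ω'} [IsProbabilityMeasure ν]

theorem eventually_measureReal_le_lt {V : ℕ → Ω → ℝ} {U : Ω' → ℝ}
    (hV : TendstoInDistribution V atTop U (fun _ => μ) ν) {x q : ℝ}
    (h : ν.real {ω | U ω ≤ x} < q) : ∀ᶠ n in atTop, μ.real {ω | V n ω ≤ x} < q := by
  have hlim := ProbabilityMeasure.limsup_measure_closed_le_of_tendsto hV.tendsto
    (isClosed_Iic (a := x))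
  simp only [ProbabilityMeasure.coe_mk] at hlim
  rw [Measure.map_apply_of_aemeasurable hV.aemeasurable_limit measurableSet_Iic] at hlim
  have hq : ν (U ⁻¹' Set.Iic x) < ENNReal.ofReal q := by
    rw [ENNReal.lt_ofReal_iff_toReal_lt (measure_ne_top _ _)]
    exact h
  filter_upwards [eventually_lt_of_limsup_lt (hlim.trans_lt hq)] with n hn
  rw [Measure.map_apply_of_aemeasurable (hV.forall_aemeasurable n) measurableSet_Iic,
    ENNReal.lt_ofReal_iff_toReal_lt (measure_ne_top _ _)] at hn
  exact hn

theorem eventually_lt_measureReal_lt {V : ℕ → Ω → ℝ} {U : Ω' → ℝ}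
    (hV : TendstoInDistribution V atTop U (fun _ => μ) ν) {x q : ℝ} (hq : 0 ≤ q)
    (h : q < ν.real {ω | U ω < x}) : ∀ᶠ n in atTop, q < μ.real {ω | V n ω < x} := by
  have hlim := ProbabilityMeasure.le_liminf_measure_open_of_tendsto hV.tendsto
    (isOpen_Iio (a := x))
  simp only [ProbabilityMeasure.coe_mk] at hlim
  rw [Measure.map_apply_of_aemeasurable hV.aemeasurable_limit measurableSet_Iio] at hlim
  have hq' : ENNReal.ofReal q < ν (U ⁻¹' Set.Iio x) := by
    rw [ENNReal.ofReal_lt_iff_lt_toReal hq (measure_ne_top _ _)]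
    exact h
  filter_upwards [eventually_lt_of_lt_liminf (hq'.trans_le hlim)] with n hn
  rw [Measure.map_apply_of_aemeasurable (hV.forall_aemeasurable n) measurableSet_Iio,
    ENNReal.ofReal_lt_iff_lt_toReal hq (measure_ne_top _ _)] at hn
  exact hn

/-- Below the quantile of `U` the distribution function is strictly less than `p`, and portmanteau
for closed half-lines transfers this to `V n`. A level `q` strictly in between absorbs the vanishing
probability that `V n ≤ X n` fails. -/
theorem quantile_le_liminf_quantile {V X : ℕ → Ω → ℝ} {U : Ω' → ℝ}
    (hV : TendstoInDistribution V atTop U (fun _ => μ) ν) (hX : ∀ n, AEMeasurable (X n) μ)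
    (hVX : ∀ᵐ ω ∂μ, ∀ᶠ n in atTop, V n ω ≤ X n ω) {p : ℝ} (hp0 : 0 < p) (hp1 : p < 1) :
    (quantile ν U p : EReal) ≤ liminf (fun n => (quantile μ (X n) p : EReal)) atTop := by
  refine EReal.ge_of_forall_gt_iff_ge.1 fun x hx => ?_
  rw [EReal.coe_lt_coe_iff] at hx
  obtain ⟨q, hq1, hq2⟩ := exists_between
    (measureReal_lt_of_lt_quantile hV.aemeasurable_limit hp0 hx)
  have hbad := tendsto_measureReal_compl_of_ae_eventually_mem
    (fun n => nullMeasurableSet_le (hV.forall_aemeasurable n) (hX n)) hVX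
  refine le_liminf_of_le (by isBoundedDefault) ?_
  filter_upwards [eventually_measureReal_le_lt hV hq1,
    hbad.eventually (gt_mem_nhds (sub_pos.2 hq2))] with n hn1 hn2
  rw [EReal.coe_le_coe_iff]
  refine le_quantile_of_lt (hX n) hp1 ?_
  calc μ.real {ω | X n ω ≤ x}
      ≤ μ.real ({ω | V n ω ≤ x} ∪ {ω | V n ω ≤ X n ω}ᶜ) := by
        refine measureReal_mono fun ω hω => ?_
        by_cases h : V n ω ≤ X n ω
        · exact Or.inl (h.trans hω)
        · exact Or.inr h
    _ ≤ _ := measureReal_union_le _ _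
    _ < p := by linarith

/-- Beyond the quantile of `U` the distribution function is a priori only at least `p`. If it were
flat at that level, the quantiles of `V n` could stay to the right of the flat piece; `hU` excludes
this and leaves room for the bad event. -/
theorem limsup_quantile_le_quantile {V X : ℕ → Ω → ℝ} {U : Ω' → ℝ}
    (hV : TendstoInDistribution V atTop U (fun _ => μ) ν) (hX : ∀ n, AEMeasurable (X n) μ)
    (hXV : ∀ᵐ ω ∂μ, ∀ᶠ n in atTop, X n ω ≤ V n ω) {p : ℝ} (hp0 : 0 < p)
    (hU : ∀ x, quantile ν U p < x → p < ν.real {ω | U ω < x}) :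
    limsup (fun n => (quantile μ (X n) p : EReal)) atTop ≤ (quantile ν U p : EReal) := by
  refine EReal.le_of_forall_lt_iff_le.1 fun x hx => ?_
  rw [EReal.coe_lt_coe_iff] at hx
  obtain ⟨q, hq1, hq2⟩ := exists_between (hU x hx)
  have hbad := tendsto_measureReal_compl_of_ae_eventually_mem
    (fun n => nullMeasurableSet_le (hX n) (hV.forall_aemeasurable n)) hXV
  refine limsup_le_of_le (by isBoundedDefault) ?_
  filter_upwards [eventually_lt_measureReal_lt hV (hp0.trans hq1).le hq2,
    hbad.eventually (gt_mem_nhds (sub_pos.2 hq1))] with n hn1 hn2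
  rw [EReal.coe_le_coe_iff]
  refine quantile_le_of_le (hX n) hp0 ?_
  have : μ.real {ω | V n ω < x} ≤ μ.real {ω | X n ω ≤ x} + μ.real {ω | X n ω ≤ V n ω}ᶜ := by
    refine le_trans (measureReal_mono fun ω hω => ?_) (measureReal_union_le _ _)
    by_cases h : X n ω ≤ V n ω
    · exact Or.inl (h.trans (le_of_lt hω))
    · exact Or.inr h
  linarith

end Quantile

/-! ### Homogeneous functions of Gaussian vectors -/

instance isOpenPosMeasure_stdGaussian {ι : Type*} [Fintype ι] :
    (stdGaussian (EuclideanSpace ℝ ι)).IsOpenPosMeasure := by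
  have : (gaussianReal 0 1).IsOpenPosMeasure :=
    (gaussianReal_absolutelyContinuous' 0 one_ne_zero).isOpenPosMeasure
  rw [← map_pi_eq_stdGaussian]
  exact (PiLp.continuous_toLp 2 _).isOpenPosMeasure_map (WithLp.toLp_surjective 2)

/-- The vector `Z` has the law of `A G` with `G` standard Gaussian, a law of full support even when
`S` is singular. Either `h ∘ A` vanishes identically, or by scaling it takes every nonnegative
value. In the second case each nonempty open interval of positive reals has positive mass under the
law of `h (Z ω)`. -/
theorem lt_measureReal_lt_of_quantile_lt_of_homogeneous {ι : Type*} [Fintype ι] [DecidableEq ι]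
    {S : Matrix ι ι ℝ} {Ω' : Type*} [MeasurableSpace Ω'] {ν : Measure Ω'} [IsProbabilityMeasure ν]
    {Z : Ω' → EuclideanSpace ℝ ι} (hZ : HasLaw Z (multivariateGaussian 0 S) ν)
    {h : EuclideanSpace ℝ ι → ℝ} (hh : Continuous h) (h0 : ∀ z, 0 ≤ h z)
    (hsmul : ∀ (c : ℝ) z, h (c • z) = c ^ 2 * h z) {p : ℝ} (hp0 : 0 < p) (hp1 : p < 1) {x : ℝ}
    (hx : quantile ν (fun ω => h (Z ω)) p < x) : p < ν.real {ω | h (Z ω) < x} := by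
  have hm : AEMeasurable (fun ω => h (Z ω)) ν := hh.measurable.comp_aemeasurable hZ.aemeasurable
  obtain ⟨y, hy, hyx⟩ := exists_lt_of_csInf_lt (quantile_set_nonempty hm hp1) hx
  simp only [Set.mem_ofPred_eq] at hy
  -- Otherwise the event `h (Z ω) ≤ y` would be empty, against `0 < p`.
  have hy0 : 0 ≤ y := by
    by_contra! hneg
    have : {ω | h (Z ω) ≤ y} = ∅ := by
      ext ω
      simpa using hneg.trans_le (h0 _)
    rw [this, measureReal_empty] at hy
    linarith
  set A := Matrix.toEuclideanCLM (𝕜 := ℝ) (open scoped MatrixOrder in CFC.sqrt S) with hA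
  by_cases hz : ∀ z, h (A z) = 0
  · have h1 : ∀ᵐ ω ∂ν, h (Z ω) = 0 := by
      refine (hZ.ae_iff (p := fun z => h z = 0)
        (measurableSet_setOfPred.1 (measurableSet_eq_fun hh.measurable measurable_const))).2 ?_
      rw [multivariateGaussian, ae_map_iff (by fun_prop)
        (measurableSet_eq_fun hh.measurable measurable_const)]
      exact ae_of_all _ fun z => by simpa using hz z
    have : ν.real {ω | h (Z ω) < x} = 1 := by
      have : ν.real {ω | h (Z ω) < x} = ν.real Set.univ := by
        refine measureReal_congr ?_
        filter_upwards [h1] with ω hω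
        apply propext
        change h (Z ω) < x ↔ True
        rw [hω]
        simpa using hy0.trans_lt hyx
      simp [this]
    rwa [this]
  · push Not at hz
    obtain ⟨z₀, hz₀⟩ := hz
    have hpos : 0 < ν.real {ω | y < h (Z ω) ∧ h (Z ω) < x} := by
      have hmeas : MeasurableSet {z | y < h z ∧ h z < x} :=
        (measurableSet_lt measurable_const hh.measurable).inter
          (measurableSet_lt hh.measurable measurable_const)
      rw [hZ.measureReal_eq (p := fun z => y < h z ∧ h z < x) hmeas, multivariateGaussian,
        map_measureReal_apply (by fun_prop) hmeas, measureReal_def]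
      refine ENNReal.toReal_pos (IsOpen.measure_pos _ ?_ ?_).ne' (measure_ne_top _ _)
      · refine IsOpen.preimage (by fun_prop) ?_
        exact (isOpen_lt continuous_const hh).inter (isOpen_lt hh continuous_const)
      · have hmid : 0 ≤ (y + x) / 2 / h (A z₀) :=
          div_nonneg (by linarith) (h0 _)
        refine ⟨√((y + x) / 2 / h (A z₀)) • z₀, ?_⟩
        simp only [Set.mem_preimage, Set.mem_ofPred_eq, zero_add, map_smul]
        rw [← hA, hsmul, Real.sq_sqrt hmid, div_mul_cancel₀ _ hz₀]
        constructor <;> linarith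
    have hle : ν.real {ω | h (Z ω) ≤ y} + ν.real {ω | y < h (Z ω) ∧ h (Z ω) < x}
        ≤ ν.real {ω | h (Z ω) < x} := by
      rw [← measureReal_union₀]
      · refine measureReal_mono fun ω hω => ?_
        rcases hω with hω | hω
        · exact lt_of_le_of_lt hω hyx
        · exact hω.2
      · exact (nullMeasurableSet_lt aemeasurable_const hm).inter
          (nullMeasurableSet_lt hm aemeasurable_const)
      · refine Disjoint.aedisjoint (Set.disjoint_left.2 fun ω h1 h2 => ?_)
        exact absurd h2.1 (not_lt.2 h1)
    linarith

/-! ### The multivariate central limit theorem -/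

theorem charFun_map_eq_charFun_map_inner {E : Type*} [NormedAddCommGroup E]
    [InnerProductSpace ℝ E] [MeasurableSpace E] [BorelSpace E] [SecondCountableTopology E]
    {Ω : Type*} [MeasurableSpace Ω] {μ : Measure Ω} {X : Ω → E} (hX : AEMeasurable X μ) (t : E) :
    charFun (μ.map X) t = charFun (μ.map fun ω => inner ℝ (X ω) t) 1 := by
  rw [charFun_apply, charFun_apply, integral_map hX, integral_map]
  · simp
  · fun_prop
  · exact Measurable.aestronglyMeasurable (by fun_prop)
  · exact Measurable.aestronglyMeasurable (by fun_prop)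

/-- Cramér–Wold: the characteristic function at `x` is that of the projection onto `x`, taken at 1,
so the scalar theorem suffices. -/
theorem tendstoInDistribution_inv_sqrt_smul_sum {ι : Type*} [Fintype ι] [DecidableEq ι]
    {Ω Ω' : Type*} [MeasurableSpace Ω] [MeasurableSpace Ω'] {μ : Measure Ω} {ν : Measure Ω'}
    [IsProbabilityMeasure μ] [IsProbabilityMeasure ν] {X : ℕ → Ω → EuclideanSpace ℝ ι}
    {Z : Ω' → EuclideanSpace ℝ ι} {S : Matrix ι ι ℝ}
    (hZ : HasLaw Z (multivariateGaussian 0 S) ν)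
    (hX : ∀ a, MemLp (fun ω => X 0 ω a) 2 μ) (h0 : ∀ a, ∫ ω, X 0 ω a ∂μ = 0)
    (hS : ∀ a b, ∫ ω, X 0 ω a * X 0 ω b ∂μ = S a b) (hindep : iIndepFun X μ)
    (hident : ∀ i, IdentDistrib (X i) (X 0) μ μ) :
    TendstoInDistribution (fun (n : ℕ) ω => (√n)⁻¹ • ∑ k ∈ Finset.range n, X k ω) atTop Z
      (fun _ => μ) ν := by
  have hXm : ∀ i, AEMeasurable (X i) μ := fun i => (hident i).aemeasurable_fst
  have hin : ∀ x v : EuclideanSpace ℝ ι, inner ℝ v x = ∑ a, x a * v a := fun x v => by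
    simp [PiLp.inner_apply]
  have hL2 : ∀ x, MemLp (fun ω => inner ℝ (X 0 ω) x) 2 μ := fun x => by
    simp_rw [hin]
    exact memLp_finsetSum _ fun a _ => (hX a).const_mul _
  have hsq : ∀ x : EuclideanSpace ℝ ι,
      ∫ ω, (inner ℝ (X 0 ω) x) ^ 2 ∂μ = x.ofLp ⬝ᵥ S.mulVec x.ofLp := by
    intro x
    have : ∀ ω, (inner ℝ (X 0 ω) x) ^ 2 = ∑ a, ∑ b, x a * x b * (X 0 ω a * X 0 ω b) := by
      intro ω
      rw [hin, sq, Finset.sum_mul_sum]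
      refine Finset.sum_congr rfl fun a _ => Finset.sum_congr rfl fun b _ => by ring
    simp_rw [this]
    rw [integral_finsetSum]
    · simp only [dotProduct, Matrix.mulVec, Finset.mul_sum]
      refine Finset.sum_congr rfl fun a _ => ?_
      rw [integral_finsetSum]
      · refine Finset.sum_congr rfl fun b _ => ?_
        rw [integral_const_mul, hS]
        ring
      · exact fun b _ => ((hX a).integrable_mul (hX b)).const_mul _
    · exact fun a _ => integrable_finsetSum _ fun b _ =>
        ((hX a).integrable_mul (hX b)).const_mul _
  -- A second-moment matrix is positive semidefinite; the formula for the Gaussian characteristic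
  -- function requires this.
  have hpsd : S.PosSemidef := by
    refine Matrix.PosSemidef.of_dotProduct_mulVec_nonneg ?_ fun x => ?_
    · ext a b
      simp only [Matrix.conjTranspose_apply, star_trivial, ← hS]
      simp_rw [mul_comm]
    · have := hsq (WithLp.toLp 2 x)
      simp only [star_trivial]
      rw [← this]
      exact integral_nonneg fun _ => sq_nonneg _
  have hmean : ∀ x, ∫ ω, inner ℝ (X 0 ω) x ∂μ = 0 := fun x => by
    simp_rw [hin]
    rw [integral_finsetSum _ fun a _ => ((hX a).integrable one_le_two).const_mul _]
    simp [integral_const_mul, h0]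
  have hvar : ∀ x, Var[fun ω => inner ℝ (X 0 ω) x; μ] = x.ofLp ⬝ᵥ S.mulVec x.ofLp := fun x => by
    rw [variance_of_integral_eq_zero (hL2 x).aemeasurable (hmean x), hsq]
  have hsum : ∀ n : ℕ, AEMeasurable (fun ω => (√n)⁻¹ • ∑ k ∈ Finset.range n, X k ω) μ := fun n => by
    have := Finset.aemeasurable_fun_sum (Finset.range n) fun i _ => hXm i
    fun_prop
  refine ⟨fun n => ?_, hZ.aemeasurable, ?_⟩
  · exact hsum n
  refine ProbabilityMeasure.tendsto_iff_tendsto_charFun.2 fun x => ?_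
  simp only [ProbabilityMeasure.coe_mk]
  have hclt := tendstoInDistribution_inv_sqrt_mul_sum_sub
    (X := fun i ω => inner ℝ (X i ω) x) (P := μ) (Y := id)
    (P' := gaussianReal 0 Var[fun ω => inner ℝ (X 0 ω) x; μ].toNNReal) HasLaw.id (hL2 x)
    (hindep.comp (fun _ v => inner ℝ v x) (by fun_prop))
    (fun i => (hident i).comp (u := fun v => inner ℝ v x) (by fun_prop))
  have hcf := ProbabilityMeasure.tendsto_iff_tendsto_charFun.1 hclt.tendsto 1
  simp only [ProbabilityMeasure.coe_mk, hmean, mul_zero, sub_zero, Measure.map_id] at hcf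
  rw [hZ.map_eq, charFun_multivariateGaussian hpsd]
  convert hcf using 2 with n
  · rw [charFun_map_eq_charFun_map_inner (hsum n)]
    congr 2
    ext ω
    simp only [real_inner_smul_left, sum_inner]
  · rw [charFun_gaussianReal, hvar, Real.coe_toNNReal]
    · simp
    · rw [← hsq]
      exact integral_nonneg fun _ => sq_nonneg _

/-! ### Quadratic functions -/

section Quadratic

variable {ι : Type*} [Fintype ι] {f : EuclideanSpace ℝ ι → ℝ} {w₀ : EuclideanSpace ℝ ι}
  {b : ι → ℝ} {A : Matrix ι ι ℝ}

theorem dotProduct_mulVec_comm_of_isHermitian (hA : A.IsHermitian) (u v : ι → ℝ) :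
    u ⬝ᵥ A.mulVec v = v ⬝ᵥ A.mulVec u := by
  have h : A.transpose = A := by simpa using hA.eq
  rw [Matrix.dotProduct_mulVec, ← Matrix.mulVec_transpose, h, dotProduct_comm]

theorem quadratic_add (hA : A.IsHermitian)
    (hf : ∀ u : ι → ℝ, f (w₀ + WithLp.toLp 2 u) = f w₀ + b ⬝ᵥ u + 1 / 2 * (u ⬝ᵥ A.mulVec u))
    (u v : ι → ℝ) : f (w₀ + WithLp.toLp 2 (u + v)) =
      f (w₀ + WithLp.toLp 2 u) + (b + A.mulVec u) ⬝ᵥ v + 1 / 2 * (v ⬝ᵥ A.mulVec v) := by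
  rw [hf, hf, Matrix.mulVec_add, dotProduct_add, dotProduct_add, add_dotProduct, add_dotProduct,
    add_dotProduct, dotProduct_mulVec_comm_of_isHermitian hA u v, dotProduct_comm (A.mulVec u) v]
  ring

/-- First-order condition without differentiation. Moving by `s • r`, where `r` is the gradient at
the minimizer, changes `f` by a quadratic in `s` that is nonnegative and has no constant term. Its
discriminant `(r ⬝ᵥ r) ^ 2` must then vanish. -/
theorem mulVec_eq_neg_of_isMin_quadratic (hA : A.IsHermitian)
    (hf : ∀ u : ι → ℝ, f (w₀ + WithLp.toLp 2 u) = f w₀ + b ⬝ᵥ u + 1 / 2 * (u ⬝ᵥ A.mulVec u))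
    {u : ι → ℝ} (hmin : ∀ w, f (w₀ + WithLp.toLp 2 u) ≤ f w) : A.mulVec u = -b := by
  set r := b + A.mulVec u with hr
  have h : ∀ s : ℝ, 0 ≤ (1 / 2 * (r ⬝ᵥ A.mulVec r)) * (s * s) + (r ⬝ᵥ r) * s + 0 := fun s => by
    have h1 := hmin (w₀ + WithLp.toLp 2 (u + s • r))
    rw [quadratic_add hA hf, ← hr, Matrix.mulVec_smul, dotProduct_smul, dotProduct_smul,
      smul_dotProduct] at h1
    simp only [smul_eq_mul] at h1
    linarith
  have h2 := discrim_le_zero h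
  rw [discrim] at h2
  have h3 : r ⬝ᵥ r = 0 := by nlinarith [sq_nonneg (r ⬝ᵥ r)]
  have h4 : r = 0 := dotProduct_self_eq_zero.1 h3
  rw [hr] at h4
  exact eq_neg_of_add_eq_zero_right h4

theorem exists_isMin_quadratic [DecidableEq ι] (hA : A.PosDef)
    (hf : ∀ u : ι → ℝ, f (w₀ + WithLp.toLp 2 u) = f w₀ + b ⬝ᵥ u + 1 / 2 * (u ⬝ᵥ A.mulVec u)) :
    ∃ w, ∀ w', f w ≤ f w' := by
  have hdet : IsUnit A.det := (Matrix.isUnit_iff_isUnit_det _).1 hA.isUnit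
  set u : ι → ℝ := A⁻¹.mulVec (-b) with hu
  refine ⟨w₀ + WithLp.toLp 2 u, fun w' => ?_⟩
  have hw' : w' = w₀ + WithLp.toLp 2 (u + ((w' - w₀).ofLp - u)) := by
    rw [add_sub_cancel]
    simp
  have hAu : b + A.mulVec u = 0 := by
    rw [hu, Matrix.mulVec_mulVec, Matrix.mul_nonsing_inv _ hdet]
    simp
  rw [hw', quadratic_add hA.isHermitian hf, hAu, zero_dotProduct]
  have := hA.posSemidef.dotProduct_mulVec_nonneg ((w' - w₀).ofLp - u)
  simp only [star_trivial] at this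
  linarith

end Quadratic

theorem loss_inner_add {d : ℕ} (x w₀ : EuclideanSpace ℝ (Fin d)) (y : ℝ) (u : Fin d → ℝ) :
    loss (inner ℝ (w₀ + WithLp.toLp 2 u) x) y = loss (inner ℝ w₀ x) y +
      (fun j => (inner ℝ w₀ x - y) * x j) ⬝ᵥ u +
      1 / 2 * ∑ i, ∑ j, u i * u j * (x i * x j) := by
  have h1 : inner ℝ (WithLp.toLp 2 u) x = ∑ i, u i * x i := by
    simp [PiLp.inner_apply, mul_comm]
  have h2 : (fun j => (inner ℝ w₀ x - y) * x j) ⬝ᵥ u = (inner ℝ w₀ x - y) * ∑ i, u i * x i := by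
    simp only [dotProduct, Finset.mul_sum]
    exact Finset.sum_congr rfl fun _ _ => by ring
  have h3 : ∑ i, ∑ j, u i * u j * (x i * x j) = (∑ i, u i * x i) ^ 2 := by
    rw [sq, Finset.sum_mul_sum]
    exact Finset.sum_congr rfl fun _ _ => Finset.sum_congr rfl fun _ _ => by ring
  rw [inner_add_left, h1, h2, h3, loss, loss]
  ring

theorem dotProduct_mulVec_eq_sum_sum {ι : Type*} [Fintype ι] (u : ι → ℝ) (A : Matrix ι ι ℝ) :
    u ⬝ᵥ A.mulVec u = ∑ i, ∑ j, u i * u j * A i j := by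
  simp only [dotProduct, Matrix.mulVec, Finset.mul_sum]
  exact Finset.sum_congr rfl fun _ _ => Finset.sum_congr rfl fun _ _ => by ring

/-! ### The population problem -/

section Population

variable {T 𝒳 : Type*} [MeasurableSpace 𝒳] {d : ℕ}
  {φ : T → 𝒳 → EuclideanSpace ℝ (Fin d)} {P : Measure (𝒳 × ℝ)}

theorem memLp_feature (hφ : ∀ t, Measurable (φ t))
    (hφ2 : ∀ t j, Integrable (fun p : 𝒳 × ℝ => φ t p.1 j ^ 2) P) (t : T) (j : Fin d) :
    MemLp (fun p : 𝒳 × ℝ => φ t p.1 j) 2 P :=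
  (memLp_two_iff_integrable_sq
    (Measurable.aestronglyMeasurable (by have := hφ t; fun_prop))).2 (hφ2 t j)

theorem memLp_response (hY2 : Integrable (fun p : 𝒳 × ℝ => p.2 ^ 2) P) :
    MemLp (fun p : 𝒳 × ℝ => p.2) 2 P :=
  (memLp_two_iff_integrable_sq (Measurable.aestronglyMeasurable (by fun_prop))).2 hY2

theorem memLp_residual (hφ : ∀ t, Measurable (φ t))
    (hφ2 : ∀ t j, Integrable (fun p : 𝒳 × ℝ => φ t p.1 j ^ 2) P)
    (hY2 : Integrable (fun p : 𝒳 × ℝ => p.2 ^ 2) P) (t : T) (w : EuclideanSpace ℝ (Fin d)) :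
    MemLp (fun p : 𝒳 × ℝ => inner ℝ w (φ t p.1) - p.2) 2 P := by
  refine MemLp.sub ?_ (memLp_response hY2)
  have h1 : ∀ p : 𝒳 × ℝ, inner ℝ w (φ t p.1) = ∑ j, w j * φ t p.1 j := fun p => by
    simp [PiLp.inner_apply, mul_comm]
  simp_rw [h1]
  exact memLp_finsetSum _ fun j _ => (memLp_feature hφ hφ2 t j).const_mul _

theorem integrable_loss (hφ : ∀ t, Measurable (φ t))
    (hφ2 : ∀ t j, Integrable (fun p : 𝒳 × ℝ => φ t p.1 j ^ 2) P)
    (hY2 : Integrable (fun p : 𝒳 × ℝ => p.2 ^ 2) P) (t : T) (w : EuclideanSpace ℝ (Fin d)) :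
    Integrable (fun p : 𝒳 × ℝ => loss (inner ℝ w (φ t p.1)) p.2) P :=
  (memLp_residual hφ hφ2 hY2 t w).integrable_sq.div_const 2

theorem risk_add (hφ : ∀ t, Measurable (φ t))
    (hφ2 : ∀ t j, Integrable (fun p : 𝒳 × ℝ => φ t p.1 j ^ 2) P)
    (hY2 : Integrable (fun p : 𝒳 × ℝ => p.2 ^ 2) P) (t : T) (w₀ : EuclideanSpace ℝ (Fin d))
    (u : Fin d → ℝ) :
    risk P φ t (w₀ + WithLp.toLp 2 u) = risk P φ t w₀ +
      (fun j => ∫ p, (inner ℝ w₀ (φ t p.1) - p.2) * φ t p.1 j ∂P) ⬝ᵥ u +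
      1 / 2 * (u ⬝ᵥ (covMat P φ t).mulVec u) := by
  have h1 : ∀ j, Integrable (fun p => (inner ℝ w₀ (φ t p.1) - p.2) * φ t p.1 j * u j) P := fun j =>
    ((memLp_residual hφ hφ2 hY2 t w₀).integrable_mul (memLp_feature hφ hφ2 t j)).mul_const _
  have h2 : ∀ i j, Integrable (fun p => u i * u j * (φ t p.1 i * φ t p.1 j)) P := fun i j =>
    ((memLp_feature hφ hφ2 t i).integrable_mul (memLp_feature hφ hφ2 t j)).const_mul _
  have h3 : Integrable (fun p => loss (inner ℝ w₀ (φ t p.1)) p.2 +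
      ∑ j, (inner ℝ w₀ (φ t p.1) - p.2) * φ t p.1 j * u j) P :=
    (integrable_loss hφ hφ2 hY2 t w₀).add (integrable_finsetSum _ fun j _ => h1 j)
  unfold risk
  simp_rw [loss_inner_add, dotProduct_mulVec_eq_sum_sum, dotProduct]
  rw [integral_add h3
    ((integrable_finsetSum _ fun i _ => integrable_finsetSum _ fun j _ => h2 i j).const_mul _),
    integral_add (integrable_loss hφ hφ2 hY2 t w₀) (integrable_finsetSum _ fun j _ => h1 j),
    integral_finsetSum _ fun j _ => h1 j, integral_const_mul,
    integral_finsetSum _ fun i _ => integrable_finsetSum _ fun j _ => h2 i j]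
  congr 2
  · exact Finset.sum_congr rfl fun j _ => integral_mul_const _ _
  · refine Finset.sum_congr rfl fun i _ => ?_
    rw [integral_finsetSum _ fun j _ => h2 i j]
    exact Finset.sum_congr rfl fun j _ => integral_const_mul _ _

/-- The quadratic form at `u` is `𝔼⟨u, φ_t(X)⟩²`; if it vanished, `φ_t(X)` would lie almost surely
in the hyperplane orthogonal to `u`. -/
theorem posDef_covMat (hφ : ∀ t, Measurable (φ t))
    (hsupp : ∀ t, ∀ v : EuclideanSpace ℝ (Fin d), v ≠ 0 → ¬ ∀ᵐ p ∂P, inner ℝ v (φ t p.1) = 0)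
    (hφ2 : ∀ t j, Integrable (fun p : 𝒳 × ℝ => φ t p.1 j ^ 2) P) (t : T) :
    (covMat P φ t).PosDef := by
  refine Matrix.PosDef.of_dotProduct_mulVec_pos ?_ fun u hu => ?_
  · ext i j
    simp only [Matrix.conjTranspose_apply, star_trivial, covMat, Matrix.of_apply]
    simp_rw [mul_comm]
  · have h2 : ∀ i j, Integrable (fun p : 𝒳 × ℝ => u i * u j * (φ t p.1 i * φ t p.1 j)) P :=
      fun i j =>
      ((memLp_feature hφ hφ2 t i).integrable_mul (memLp_feature hφ hφ2 t j)).const_mul _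
    have h3 : ∀ p : 𝒳 × ℝ, ∑ i, ∑ j, u i * u j * (φ t p.1 i * φ t p.1 j) =
        (inner ℝ (WithLp.toLp 2 u) (φ t p.1)) ^ 2 := fun p => by
      have h1 : inner ℝ (WithLp.toLp 2 u) (φ t p.1) = ∑ i, u i * φ t p.1 i := by
        simp [PiLp.inner_apply, mul_comm]
      rw [h1, sq, Finset.sum_mul_sum]
      exact Finset.sum_congr rfl fun _ _ => Finset.sum_congr rfl fun _ _ => by ring
    have hint : Integrable (fun p : 𝒳 × ℝ => (inner ℝ (WithLp.toLp 2 u) (φ t p.1)) ^ 2) P := by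
      simp_rw [← h3]
      exact integrable_finsetSum _ fun i _ => integrable_finsetSum _ fun j _ => h2 i j
    have h4 : u ⬝ᵥ (covMat P φ t).mulVec u =
        ∫ p, (inner ℝ (WithLp.toLp 2 u) (φ t p.1)) ^ 2 ∂P := by
      simp_rw [← h3, dotProduct_mulVec_eq_sum_sum]
      rw [integral_finsetSum _ fun i _ => integrable_finsetSum _ fun j _ => h2 i j]
      refine Finset.sum_congr rfl fun i _ => ?_
      rw [integral_finsetSum _ fun j _ => h2 i j]
      exact Finset.sum_congr rfl fun j _ => (integral_const_mul _ _).symm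
    rw [star_trivial, h4]
    refine lt_of_le_of_ne (integral_nonneg fun _ => sq_nonneg _) fun h => ?_
    rw [eq_comm, integral_eq_zero_iff_of_nonneg (fun _ => sq_nonneg _) hint] at h
    refine hsupp t (WithLp.toLp 2 u) (by simpa using hu) ?_
    filter_upwards [h] with p hp
    simpa using hp

theorem isUnit_det_covMat (hφ : ∀ t, Measurable (φ t))
    (hsupp : ∀ t, ∀ v : EuclideanSpace ℝ (Fin d), v ≠ 0 → ¬ ∀ᵐ p ∂P, inner ℝ v (φ t p.1) = 0)
    (hφ2 : ∀ t j, Integrable (fun p : 𝒳 × ℝ => φ t p.1 j ^ 2) P) (t : T) :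
    IsUnit (covMat P φ t).det :=
  (Matrix.isUnit_iff_isUnit_det _).1 (posDef_covMat hφ hsupp hφ2 t).isUnit

theorem risk_wStar_le (hφ : ∀ t, Measurable (φ t))
    (hsupp : ∀ t, ∀ v : EuclideanSpace ℝ (Fin d), v ≠ 0 → ¬ ∀ᵐ p ∂P, inner ℝ v (φ t p.1) = 0)
    (hφ2 : ∀ t j, Integrable (fun p : 𝒳 × ℝ => φ t p.1 j ^ 2) P)
    (hY2 : Integrable (fun p : 𝒳 × ℝ => p.2 ^ 2) P) (t : T) (w : EuclideanSpace ℝ (Fin d)) :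
    risk P φ t (wStar P φ t) ≤ risk P φ t w :=
  Classical.epsilon_spec (p := fun w => ∀ w', risk P φ t w ≤ risk P φ t w')
    (exists_isMin_quadratic (posDef_covMat hφ hsupp hφ2 t) (risk_add hφ hφ2 hY2 t 0)) w

theorem lossGrad_apply (t : T) (p : 𝒳 × ℝ) (j : Fin d) :
    lossGrad P φ t p j = (inner ℝ (wStar P φ t) (φ t p.1) - p.2) * φ t p.1 j := by
  have h : HasGradientAt (fun w => loss (inner ℝ w (φ t p.1)) p.2)
      ((inner ℝ (wStar P φ t) (φ t p.1) - p.2) • φ t p.1) (wStar P φ t) := by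
    rw [hasGradientAt_iff_hasFDerivAt]
    have h1 : HasFDerivAt (fun w : EuclideanSpace ℝ (Fin d) => inner ℝ w (φ t p.1))
        (innerSL ℝ (φ t p.1)) (wStar P φ t) := by
      have := (innerSL ℝ (φ t p.1)).hasFDerivAt (x := wStar P φ t)
      refine this.congr_of_eventuallyEq (Eventually.of_forall fun w => ?_)
      simp [real_inner_comm]
    have h2 := ((h1.sub_const p.2).pow 2).mul_const (2⁻¹ : ℝ)
    refine (h2.congr_of_eventuallyEq (Eventually.of_forall fun w => ?_)).congr_fderiv ?_
    · simp [loss, div_eq_mul_inv]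
    · ext v
      simp
      ring
  rw [lossGrad, h.gradient]
  simp

theorem measurable_lossGrad_apply (hφ : ∀ t, Measurable (φ t)) (t : T) (j : Fin d) :
    Measurable fun p => lossGrad P φ t p j := by
  simp_rw [lossGrad_apply]
  have := hφ t
  fun_prop

theorem integrable_lossGrad (hφ : ∀ t, Measurable (φ t))
    (hφ2 : ∀ t j, Integrable (fun p : 𝒳 × ℝ => φ t p.1 j ^ 2) P)
    (hY2 : Integrable (fun p : 𝒳 × ℝ => p.2 ^ 2) P) (t : T) (j : Fin d) :
    Integrable (fun p => lossGrad P φ t p j) P := by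
  simp_rw [lossGrad_apply]
  exact (memLp_residual hφ hφ2 hY2 t _).integrable_mul (memLp_feature hφ hφ2 t j)

theorem integral_lossGrad (hφ : ∀ t, Measurable (φ t))
    (hsupp : ∀ t, ∀ v : EuclideanSpace ℝ (Fin d), v ≠ 0 → ¬ ∀ᵐ p ∂P, inner ℝ v (φ t p.1) = 0)
    (hφ2 : ∀ t j, Integrable (fun p : 𝒳 × ℝ => φ t p.1 j ^ 2) P)
    (hY2 : Integrable (fun p : 𝒳 × ℝ => p.2 ^ 2) P) (t : T) (j : Fin d) :
    ∫ p, lossGrad P φ t p j ∂P = 0 := by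
  have h := mulVec_eq_neg_of_isMin_quadratic (u := 0)
    (posDef_covMat hφ hsupp hφ2 t).isHermitian (risk_add hφ hφ2 hY2 t (wStar P φ t))
    (fun w => by simpa using risk_wStar_le hφ hsupp hφ2 hY2 t w)
  rw [Matrix.mulVec_zero] at h
  have := congrFun h j
  simp only [Pi.zero_apply, Pi.neg_apply] at this
  simp_rw [lossGrad_apply]
  linarith

theorem risk_wStar_add (hφ : ∀ t, Measurable (φ t))
    (hsupp : ∀ t, ∀ v : EuclideanSpace ℝ (Fin d), v ≠ 0 → ¬ ∀ᵐ p ∂P, inner ℝ v (φ t p.1) = 0)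
    (hφ2 : ∀ t j, Integrable (fun p : 𝒳 × ℝ => φ t p.1 j ^ 2) P)
    (hY2 : Integrable (fun p : 𝒳 × ℝ => p.2 ^ 2) P) (t : T) (u : Fin d → ℝ) :
    risk P φ t (wStar P φ t + WithLp.toLp 2 u) = risk P φ t (wStar P φ t) +
      1 / 2 * (u ⬝ᵥ (covMat P φ t).mulVec u) := by
  have h := integral_lossGrad hφ hsupp hφ2 hY2 t
  simp_rw [lossGrad_apply] at h
  rw [risk_add hφ hφ2 hY2]
  simp [h, dotProduct]

theorem tStar_nonempty [Finite T] [Nonempty T] : (tStar P φ).Nonempty :=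
  Finite.exists_min fun t => risk P φ t (wStar P φ t)

theorem excessRisk_of_mem_tStar (hφ : ∀ t, Measurable (φ t))
    (hsupp : ∀ t, ∀ v : EuclideanSpace ℝ (Fin d), v ≠ 0 → ¬ ∀ᵐ p ∂P, inner ℝ v (φ t p.1) = 0)
    (hφ2 : ∀ t j, Integrable (fun p : 𝒳 × ℝ => φ t p.1 j ^ 2) P)
    (hY2 : Integrable (fun p : 𝒳 × ℝ => p.2 ^ 2) P) {t : T} (ht : t ∈ tStar P φ)
    (u : Fin d → ℝ) :
    excessRisk P φ t (wStar P φ t + WithLp.toLp 2 u) =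
      1 / 2 * (u ⬝ᵥ (covMat P φ t).mulVec u) := by
  have hle : ∀ q : T × EuclideanSpace ℝ (Fin d),
      risk P φ t (wStar P φ t) ≤ risk P φ q.1 q.2 := fun q =>
    (ht q.1).trans (risk_wStar_le hφ hsupp hφ2 hY2 _ _)
  have : Nonempty (T × EuclideanSpace ℝ (Fin d)) := ⟨(t, 0)⟩
  have hopt : optRisk P φ = risk P φ t (wStar P φ t) := by
    refine le_antisymm ?_ (le_ciInf hle)
    exact ciInf_le (f := fun q : T × EuclideanSpace ℝ (Fin d) => risk P φ q.1 q.2)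
      ⟨_, by rintro _ ⟨q, rfl⟩; exact hle q⟩ (t, wStar P φ t)
  rw [excessRisk, hopt, risk_wStar_add hφ hsupp hφ2 hY2]
  ring

/-! ### The inverse square root of the covariance -/

section
open scoped MatrixOrder

theorem covInvSqrt_isHermitian (t : T) : (covInvSqrt P φ t).IsHermitian :=
  (Matrix.nonneg_iff_posSemidef.1 (CFC.sqrt_nonneg (covMat P φ t))).isHermitian.inv

/-- These three identities are all that is used below about the square root of `Σ(t)`. -/
theorem exists_sqrt_covMat (hφ : ∀ t, Measurable (φ t))
    (hsupp : ∀ t, ∀ v : EuclideanSpace ℝ (Fin d), v ≠ 0 → ¬ ∀ᵐ p ∂P, inner ℝ v (φ t p.1) = 0)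
    (hφ2 : ∀ t j, Integrable (fun p : 𝒳 × ℝ => φ t p.1 j ^ 2) P) (t : T) :
    ∃ C : Matrix (Fin d) (Fin d) ℝ, C.IsHermitian ∧ C * C = covMat P φ t ∧
      C * covInvSqrt P φ t = 1 := by
  have hpd := posDef_covMat hφ hsupp hφ2 t
  have hmul : CFC.sqrt (covMat P φ t) * CFC.sqrt (covMat P φ t) = covMat P φ t :=
    CFC.sqrt_mul_sqrt_self _ hpd.posSemidef.nonneg
  have hdet : IsUnit (CFC.sqrt (covMat P φ t)).det := by
    have h := isUnit_det_covMat hφ hsupp hφ2 t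
    rw [← hmul, Matrix.det_mul] at h
    exact isUnit_of_mul_isUnit_left h
  exact ⟨CFC.sqrt (covMat P φ t), (Matrix.nonneg_iff_posSemidef.1 (CFC.sqrt_nonneg (covMat P φ t))).isHermitian, hmul,
    Matrix.mul_nonsing_inv _ hdet⟩

end

/-- The whitened gradient `Σ(t)^{-1/2} g(t, p)`. -/
noncomputable def whitenedGrad (P : Measure (𝒳 × ℝ)) (φ : T → 𝒳 → EuclideanSpace ℝ (Fin d)) (t : T)
    (p : 𝒳 × ℝ) : Fin d → ℝ :=
  (covInvSqrt P φ t).mulVec (lossGrad P φ t p).ofLp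

theorem measurable_whitenedGrad_apply (hφ : ∀ t, Measurable (φ t)) (t : T) (j : Fin d) :
    Measurable fun p => whitenedGrad P φ t p j := by
  simp only [whitenedGrad, Matrix.mulVec, dotProduct]
  exact Finset.measurable_fun_sum _ fun i _ => (measurable_lossGrad_apply hφ t i).const_mul _

/-- The squared Euclidean norm of the whitened gradient is `‖g‖²` in the `Σ⁻¹` norm, so the moment
assumption on `g` is exactly what the central limit theorem needs. -/
theorem memLp_whitenedGrad (hφ : ∀ t, Measurable (φ t))
    (hsupp : ∀ t, ∀ v : EuclideanSpace ℝ (Fin d), v ≠ 0 → ¬ ∀ᵐ p ∂P, inner ℝ v (φ t p.1) = 0)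
    (hφ2 : ∀ t j, Integrable (fun p : 𝒳 × ℝ => φ t p.1 j ^ 2) P)
    (hg2 : ∀ t, Integrable (lossGradSqNorm P φ t) P) (t : T) (j : Fin d) :
    MemLp (fun p => whitenedGrad P φ t p j) 2 P := by
  obtain ⟨C, -, hCC, hCB⟩ := exists_sqrt_covMat hφ hsupp hφ2 t
  have hinv : (covMat P φ t)⁻¹ = covInvSqrt P φ t * covInvSqrt P φ t := by
    refine Matrix.inv_eq_right_inv ?_
    rw [← hCC, Matrix.mul_assoc, ← Matrix.mul_assoc C (covInvSqrt P φ t), hCB, Matrix.one_mul, hCB]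
  have hnorm : ∀ p, lossGradSqNorm P φ t p = whitenedGrad P φ t p ⬝ᵥ whitenedGrad P φ t p := by
    intro p
    rw [lossGradSqNorm, hinv, ← Matrix.mulVec_mulVec,
      dotProduct_mulVec_comm_of_isHermitian (covInvSqrt_isHermitian t)]
    rfl
  have hm := (measurable_whitenedGrad_apply (P := P) hφ t j)
  rw [memLp_two_iff_integrable_sq hm.aestronglyMeasurable]
  refine (hg2 t).mono' (hm.pow_const 2).aestronglyMeasurable (ae_of_all _ fun p => ?_)
  rw [hnorm, Real.norm_of_nonneg (sq_nonneg _), sq]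
  exact Finset.single_le_sum (f := fun i => whitenedGrad P φ t p i * whitenedGrad P φ t p i)
    (fun i _ => mul_self_nonneg _) (Finset.mem_univ j)

theorem lossGrad_eq_mulVec_whitenedGrad {C : Matrix (Fin d) (Fin d) ℝ} {t : T}
    (hC : C * covInvSqrt P φ t = 1) (p : 𝒳 × ℝ) :
    (lossGrad P φ t p).ofLp = C.mulVec (whitenedGrad P φ t p) := by
  rw [whitenedGrad, Matrix.mulVec_mulVec, hC, Matrix.one_mulVec]

theorem memLp_lossGrad (hφ : ∀ t, Measurable (φ t))
    (hsupp : ∀ t, ∀ v : EuclideanSpace ℝ (Fin d), v ≠ 0 → ¬ ∀ᵐ p ∂P, inner ℝ v (φ t p.1) = 0)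
    (hφ2 : ∀ t j, Integrable (fun p : 𝒳 × ℝ => φ t p.1 j ^ 2) P)
    (hg2 : ∀ t, Integrable (lossGradSqNorm P φ t) P) (t : T) (j : Fin d) :
    MemLp (fun p => lossGrad P φ t p j) 2 P := by
  obtain ⟨C, -, -, hCB⟩ := exists_sqrt_covMat hφ hsupp hφ2 t
  simp_rw [lossGrad_eq_mulVec_whitenedGrad hCB, Matrix.mulVec, dotProduct]
  exact memLp_finsetSum _ fun i _ => (memLp_whitenedGrad hφ hsupp hφ2 hg2 t i).const_mul _

theorem integral_whitenedGrad (hφ : ∀ t, Measurable (φ t))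
    (hsupp : ∀ t, ∀ v : EuclideanSpace ℝ (Fin d), v ≠ 0 → ¬ ∀ᵐ p ∂P, inner ℝ v (φ t p.1) = 0)
    (hφ2 : ∀ t j, Integrable (fun p : 𝒳 × ℝ => φ t p.1 j ^ 2) P)
    (hY2 : Integrable (fun p : 𝒳 × ℝ => p.2 ^ 2) P) (t : T) (j : Fin d) :
    ∫ p, whitenedGrad P φ t p j ∂P = 0 := by
  simp only [whitenedGrad, Matrix.mulVec, dotProduct]
  rw [integral_finsetSum _ fun i _ => (integrable_lossGrad hφ hφ2 hY2 t i).const_mul _]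
  simp [integral_const_mul, integral_lossGrad hφ hsupp hφ2 hY2]

theorem integral_whitenedGrad_mul (hφ : ∀ t, Measurable (φ t))
    (hsupp : ∀ t, ∀ v : EuclideanSpace ℝ (Fin d), v ≠ 0 → ¬ ∀ᵐ p ∂P, inner ℝ v (φ t p.1) = 0)
    (hφ2 : ∀ t j, Integrable (fun p : 𝒳 × ℝ => φ t p.1 j ^ 2) P)
    (hg2 : ∀ t, Integrable (lossGradSqNorm P φ t) P) (t s : T) (i j : Fin d) :
    ∫ p, whitenedGrad P φ t p i * whitenedGrad P φ s p j ∂P = limitCov P φ t s i j := by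
  have hint : ∀ k l, Integrable (fun p => covInvSqrt P φ t i k * covInvSqrt P φ s l j *
      (lossGrad P φ t p k * lossGrad P φ s p l)) P := fun k l =>
    ((memLp_lossGrad hφ hsupp hφ2 hg2 t k).integrable_mul
      (memLp_lossGrad hφ hsupp hφ2 hg2 s l)).const_mul _
  have hsymm : ∀ l, covInvSqrt P φ s j l = covInvSqrt P φ s l j := fun l => by
    simpa using (covInvSqrt_isHermitian (P := P) (φ := φ) s).apply l j
  have h : ∀ p, whitenedGrad P φ t p i * whitenedGrad P φ s p j =
      ∑ l, ∑ k, covInvSqrt P φ t i k * covInvSqrt P φ s l j *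
        (lossGrad P φ t p k * lossGrad P φ s p l) := by
    intro p
    simp only [whitenedGrad, Matrix.mulVec, dotProduct, hsymm]
    rw [Finset.sum_mul_sum, Finset.sum_comm]
    exact Finset.sum_congr rfl fun _ _ => Finset.sum_congr rfl fun _ _ => by ring
  simp_rw [h]
  rw [integral_finsetSum _ fun l _ => integrable_finsetSum _ fun k _ => hint k l]
  simp only [limitCov, Matrix.mul_apply, Finset.sum_mul]
  refine Finset.sum_congr rfl fun l _ => ?_
  rw [integral_finsetSum _ fun k _ => hint k l]
  refine Finset.sum_congr rfl fun k _ => ?_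
  rw [integral_const_mul, gradCov, Matrix.of_apply]
  ring

end Population

/-! ### The empirical problem -/

section Empirical

variable {T 𝒳 : Type*} {d : ℕ}

/-- The empirical covariance matrix of the features `φ t` on the first `n` data points. -/
noncomputable def empCov (φ : T → 𝒳 → EuclideanSpace ℝ (Fin d)) (z : ℕ → 𝒳 × ℝ) (n : ℕ) (t : T) :
    Matrix (Fin d) (Fin d) ℝ :=
  Matrix.of fun i j => (n : ℝ)⁻¹ * ∑ k ∈ Finset.range n, φ t (z k).1 i * φ t (z k).1 j

theorem empCov_isHermitian {φ : T → 𝒳 → EuclideanSpace ℝ (Fin d)} (z : ℕ → 𝒳 × ℝ) (n : ℕ) (t : T) : (empCov φ z n t).IsHermitian := by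
  ext i j
  simp only [Matrix.conjTranspose_apply, star_trivial, empCov, Matrix.of_apply]
  simp_rw [mul_comm]

variable [MeasurableSpace 𝒳]

/-- The gradient of the empirical risk at `wStar P φ t`. -/
noncomputable def empGrad (P : Measure (𝒳 × ℝ)) (φ : T → 𝒳 → EuclideanSpace ℝ (Fin d)) (z : ℕ → 𝒳 × ℝ)
    (n : ℕ) (t : T) : Fin d → ℝ :=
  fun j => (n : ℝ)⁻¹ * ∑ k ∈ Finset.range n, lossGrad P φ t (z k) j

/-- The estimation error of least squares with the features `φ t`, when the empirical covariance
is invertible. -/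
noncomputable def empError (P : Measure (𝒳 × ℝ)) (φ : T → 𝒳 → EuclideanSpace ℝ (Fin d)) (z : ℕ → 𝒳 × ℝ)
    (n : ℕ) (t : T) : Fin d → ℝ :=
  (empCov φ z n t)⁻¹.mulVec (-empGrad P φ z n t)

/-- The normalized sum of whitened gradients. -/
noncomputable def whitenedSum (P : Measure (𝒳 × ℝ)) (φ : T → 𝒳 → EuclideanSpace ℝ (Fin d)) (z : ℕ → 𝒳 × ℝ)
    (n : ℕ) (t : T) : Fin d → ℝ :=
  fun j => (√n)⁻¹ * ∑ k ∈ Finset.range n, whitenedGrad P φ t (z k) j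

variable {φ : T → 𝒳 → EuclideanSpace ℝ (Fin d)} {P : Measure (𝒳 × ℝ)}

theorem empRisk_wStar_add (z : ℕ → 𝒳 × ℝ) (n : ℕ) (t : T) (u : Fin d → ℝ) :
    empRisk φ z n t (wStar P φ t + WithLp.toLp 2 u) = empRisk φ z n t (wStar P φ t) +
      empGrad P φ z n t ⬝ᵥ u + 1 / 2 * (u ⬝ᵥ (empCov φ z n t).mulVec u) := by
  unfold empRisk
  simp_rw [loss_inner_add, dotProduct_mulVec_eq_sum_sum, Finset.sum_add_distrib, mul_add]
  congr 1
  · congr 1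
    simp only [dotProduct, empGrad, lossGrad_apply]
    rw [Finset.sum_comm, Finset.mul_sum]
    refine Finset.sum_congr rfl fun j _ => ?_
    rw [← Finset.sum_mul, mul_assoc]
  · rw [← Finset.mul_sum, mul_left_comm]
    congr 1
    rw [Finset.sum_comm, Finset.mul_sum]
    refine Finset.sum_congr rfl fun i _ => ?_
    rw [Finset.sum_comm, Finset.mul_sum]
    refine Finset.sum_congr rfl fun j _ => ?_
    rw [← Finset.mul_sum, empCov, Matrix.of_apply]
    ring

theorem eq_wStar_add_empError {z : ℕ → 𝒳 × ℝ} {n : ℕ} {t : T} {w : EuclideanSpace ℝ (Fin d)}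
    (hdet : (empCov φ z n t).det ≠ 0) (hmin : ∀ w', empRisk φ z n t w ≤ empRisk φ z n t w') :
    w = wStar P φ t + WithLp.toLp 2 (empError P φ z n t) := by
  have hw : w = wStar P φ t + WithLp.toLp 2 (w - wStar P φ t).ofLp := by simp
  have h := mulVec_eq_neg_of_isMin_quadratic (f := empRisk φ z n t) (w₀ := wStar P φ t)
    (u := (w - wStar P φ t).ofLp) (empCov_isHermitian z n t) (empRisk_wStar_add z n t)
    (fun w' => by rw [← hw]; exact hmin w')
  conv_lhs => rw [hw]
  rw [empError, ← h, Matrix.mulVec_mulVec, Matrix.nonsing_inv_mul _ hdet.isUnit, Matrix.one_mulVec]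

theorem empRisk_wStar_add_empError {z : ℕ → 𝒳 × ℝ} {n : ℕ} {t : T}
    (hdet : (empCov φ z n t).det ≠ 0) :
    empRisk φ z n t (wStar P φ t + WithLp.toLp 2 (empError P φ z n t)) =
      empRisk φ z n t (wStar P φ t) + 1 / 2 * (empGrad P φ z n t ⬝ᵥ empError P φ z n t) := by
  have h : (empCov φ z n t).mulVec (empError P φ z n t) = -empGrad P φ z n t := by
    rw [empError, Matrix.mulVec_mulVec, Matrix.mul_nonsing_inv _ hdet.isUnit, Matrix.one_mulVec]
  rw [empRisk_wStar_add, h, dotProduct_neg, dotProduct_comm (empError P φ z n t)]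
  ring

theorem tendsto_inv_empCov {z : ℕ → 𝒳 × ℝ} {t : T} (hdet : IsUnit (covMat P φ t).det)
    (h : Tendsto (fun n => empCov φ z n t) atTop (𝓝 (covMat P φ t))) :
    Tendsto (fun n => (empCov φ z n t)⁻¹) atTop (𝓝 (covMat P φ t)⁻¹) := by
  have hc : ContinuousAt Ring.inverse (covMat P φ t).det := by
    rw [Ring.inverse_eq_inv']
    exact continuousAt_inv₀ hdet.ne_zero
  exact (continuousAt_matrix_inv _ hc).tendsto.comp h

/-- The deterministic core, on one sample path. An optimal `t₀` with the fixed competitor `w_*(t₀)`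
eventually beats the least empirical risk of every suboptimal `t`, because the limits are strictly
ordered. -/
theorem eventually_mem_tStar_and_eq [Finite T] {z : ℕ → 𝒳 × ℝ} {that : ℕ → T}
    {what : ℕ → EuclideanSpace ℝ (Fin d)} (hdet : ∀ t, IsUnit (covMat P φ t).det)
    (hrisk : ∀ t, Tendsto (fun n => empRisk φ z n t (wStar P φ t)) atTop
      (𝓝 (risk P φ t (wStar P φ t))))
    (hgrad : ∀ t, Tendsto (fun n => empGrad P φ z n t) atTop (𝓝 0))
    (hcov : ∀ t, Tendsto (fun n => empCov φ z n t) atTop (𝓝 (covMat P φ t)))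
    (herm : ∀ n, 1 ≤ n → ∀ t w, empRisk φ z n (that n) (what n) ≤ empRisk φ z n t w) :
    ∀ᶠ n in atTop, that n ∈ tStar P φ ∧
      what n = wStar P φ (that n) + WithLp.toLp 2 (empError P φ z n (that n)) := by
  have : Nonempty T := ⟨that 0⟩
  obtain ⟨t₀, ht₀⟩ := tStar_nonempty (P := P) (φ := φ)
  have hdet' : ∀ᶠ n in atTop, ∀ t, (empCov φ z n t).det ≠ 0 := by
    refine eventually_all.2 fun t => ?_
    have h := (continuous_id.matrix_det.tendsto (covMat P φ t)).comp (hcov t)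
    exact h.eventually_ne (hdet t).ne_zero
  have herr : ∀ t, Tendsto (fun n => empRisk φ z n t (wStar P φ t) +
      1 / 2 * (empGrad P φ z n t ⬝ᵥ empError P φ z n t)) atTop
      (𝓝 (risk P φ t (wStar P φ t))) := by
    intro t
    have h1 : Tendsto (fun n => empError P φ z n t) atTop
        (𝓝 ((covMat P φ t)⁻¹.mulVec (-(0 : Fin d → ℝ)))) := by
      have hc : Continuous fun q : Matrix (Fin d) (Fin d) ℝ × (Fin d → ℝ) => q.1.mulVec q.2 :=
        continuous_fst.matrix_mulVec continuous_snd
      exact (hc.tendsto _).comp ((tendsto_inv_empCov (hdet t) (hcov t)).prodMk_nhds (hgrad t).neg)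
    have hc : Continuous fun q : (Fin d → ℝ) × (Fin d → ℝ) => q.1 ⬝ᵥ q.2 :=
      continuous_fst.dotProduct continuous_snd
    have h2 := (hc.tendsto _).comp ((hgrad t).prodMk_nhds h1)
    have h3 := (hrisk t).add (h2.const_mul (1 / 2))
    rwa [zero_dotProduct, mul_zero, add_zero] at h3
  have hsep : ∀ᶠ n in atTop, ∀ t, t ∉ tStar P φ → empRisk φ z n t₀ (wStar P φ t₀) <
      empRisk φ z n t (wStar P φ t) + 1 / 2 * (empGrad P φ z n t ⬝ᵥ empError P φ z n t) := by
    refine eventually_all.2 fun t => ?_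
    by_cases ht : t ∈ tStar P φ
    · exact Eventually.of_forall fun n h => absurd ht h
    · have hlt : risk P φ t₀ (wStar P φ t₀) < risk P φ t (wStar P φ t) := by
        by_contra! hle
        exact ht fun s => hle.trans (ht₀ s)
      filter_upwards [(hrisk t₀).eventually_lt (herr t) hlt] with n hn _ using hn
  filter_upwards [hdet', hsep, eventually_ge_atTop 1] with n h1 h2 h3
  have hw := eq_wStar_add_empError (P := P) (h1 (that n)) (fun w' => herm n h3 (that n) w')
  refine ⟨?_, hw⟩
  by_contra ht
  refine absurd (herm n h3 t₀ (wStar P φ t₀)) (not_le.2 ?_)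
  rw [hw, empRisk_wStar_add_empError (h1 _)]
  exact h2 _ ht

/-- Since `√n` times the empirical gradient is `C S_n`, the vector `√n C u` with `u` the estimation
error is `-(C Σ_n⁻¹ C) S_n`. This separates a factor tending to 1 from one governed by the central
limit theorem. -/
theorem nat_mul_empError_dotProduct {C : Matrix (Fin d) (Fin d) ℝ} {t : T} (hC : C.IsHermitian)
    (hCC : C * C = covMat P φ t) (hCB : C * covInvSqrt P φ t = 1) (z : ℕ → 𝒳 × ℝ) (n : ℕ) :
    n * (empError P φ z n t ⬝ᵥ (covMat P φ t).mulVec (empError P φ z n t)) =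
      ∑ i, (C * (empCov φ z n t)⁻¹ * C).mulVec (whitenedSum P φ z n t) i ^ 2 := by
  have hgrad : √n • empGrad P φ z n t = C.mulVec (whitenedSum P φ z n t) := by
    have hn : √n * (n : ℝ)⁻¹ = (√n)⁻¹ := by
      rcases Nat.eq_zero_or_pos n with rfl | hn
      · simp
      · have : (0 : ℝ) < n := Nat.cast_pos.2 hn
        nth_rewrite 2 [← Real.sq_sqrt this.le]
        have := Real.sqrt_pos.2 this
        field_simp
    ext j
    simp only [Pi.smul_apply, smul_eq_mul, empGrad, whitenedSum, Matrix.mulVec, dotProduct]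
    rw [← mul_assoc, hn, Finset.mul_sum]
    simp_rw [lossGrad_eq_mulVec_whitenedGrad hCB, Matrix.mulVec, dotProduct, Finset.mul_sum]
    rw [Finset.sum_comm]
    exact Finset.sum_congr rfl fun _ _ => Finset.sum_congr rfl fun _ _ => by ring
  have h1 : (C * (empCov φ z n t)⁻¹ * C).mulVec (whitenedSum P φ z n t) =
      -(√n • C.mulVec (empError P φ z n t)) := by
    rw [← Matrix.mulVec_mulVec, ← hgrad, Matrix.mulVec_smul, empError, Matrix.mulVec_mulVec,
      Matrix.mulVec_neg, smul_neg, neg_neg]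
  have h2 : empError P φ z n t ⬝ᵥ (covMat P φ t).mulVec (empError P φ z n t) =
      C.mulVec (empError P φ z n t) ⬝ᵥ C.mulVec (empError P φ z n t) := by
    rw [← hCC, ← Matrix.mulVec_mulVec, dotProduct_mulVec_comm_of_isHermitian hC]
  rw [h1, h2, dotProduct, Finset.mul_sum]
  refine Finset.sum_congr rfl fun i _ => ?_
  simp only [Pi.neg_apply, Pi.smul_apply, smul_eq_mul, neg_sq, mul_pow,
    Real.sq_sqrt (Nat.cast_nonneg n)]
  ring

end Empirical

/-! ### Sampling -/

section Sampling

variable {T 𝒳 : Type*} [MeasurableSpace 𝒳] {d : ℕ}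
  {φ : T → 𝒳 → EuclideanSpace ℝ (Fin d)} {P : Measure (𝒳 × ℝ)}
  {Ω : Type*} [MeasurableSpace Ω] {μ : Measure Ω} {D : ℕ → Ω → 𝒳 × ℝ}

theorem strong_law_ae_of_hasLaw (hlaw : ∀ i, HasLaw (D i) P μ) (hindep : iIndepFun D μ)
    {f : 𝒳 × ℝ → ℝ} (hf : Measurable f) (hint : Integrable f P) :
    ∀ᵐ ω ∂μ, Tendsto (fun n : ℕ => (n : ℝ)⁻¹ * ∑ i ∈ Finset.range n, f (D i ω)) atTop
      (𝓝 (∫ p, f p ∂P)) := by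
  have hint' : Integrable (fun ω => f (D 0 ω)) μ := by
    rw [← (hlaw 0).map_eq] at hint
    exact hint.comp_aemeasurable (hlaw 0).aemeasurable
  have h := strong_law_ae (fun i ω => f (D i ω)) hint'
    (fun i j hij => (hindep.indepFun hij).comp hf hf)
    (fun i => ((hlaw i).identDistrib (hlaw 0)).comp hf)
  rw [← (hlaw 0).map_eq, integral_map (hlaw 0).aemeasurable hf.aestronglyMeasurable]
  simpa using h

theorem ae_tendsto_empirical [Finite T] (hφ : ∀ t, Measurable (φ t))
    (hsupp : ∀ t, ∀ v : EuclideanSpace ℝ (Fin d), v ≠ 0 → ¬ ∀ᵐ p ∂P, inner ℝ v (φ t p.1) = 0)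
    (hφ2 : ∀ t j, Integrable (fun p : 𝒳 × ℝ => φ t p.1 j ^ 2) P)
    (hY2 : Integrable (fun p : 𝒳 × ℝ => p.2 ^ 2) P)
    (hlaw : ∀ i, HasLaw (D i) P μ) (hindep : iIndepFun D μ) :
    ∀ᵐ ω ∂μ,
      (∀ t, Tendsto (fun n => empRisk φ (fun i => D i ω) n t (wStar P φ t)) atTop
        (𝓝 (risk P φ t (wStar P φ t)))) ∧
      (∀ t, Tendsto (fun n => empGrad P φ (fun i => D i ω) n t) atTop (𝓝 0)) ∧
      ∀ t, Tendsto (fun n => empCov φ (fun i => D i ω) n t) atTop (𝓝 (covMat P φ t)) := by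
  have h1 : ∀ᵐ ω ∂μ, ∀ t, Tendsto (fun n => empRisk φ (fun i => D i ω) n t (wStar P φ t)) atTop
      (𝓝 (risk P φ t (wStar P φ t))) :=
    ae_all_iff.2 fun t => strong_law_ae_of_hasLaw hlaw hindep
      (by unfold loss; have := hφ t; fun_prop) (integrable_loss hφ hφ2 hY2 t _)
  have h2 : ∀ᵐ ω ∂μ, ∀ t j, Tendsto (fun n => empGrad P φ (fun i => D i ω) n t j) atTop
      (𝓝 0) := by
    refine ae_all_iff.2 fun t => ae_all_iff.2 fun j => ?_
    have := strong_law_ae_of_hasLaw hlaw hindep (measurable_lossGrad_apply (P := P) hφ t j)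
      (integrable_lossGrad hφ hφ2 hY2 t j)
    rwa [integral_lossGrad hφ hsupp hφ2 hY2] at this
  have h3 : ∀ᵐ ω ∂μ, ∀ t i j, Tendsto (fun n => empCov φ (fun i => D i ω) n t i j) atTop
      (𝓝 (covMat P φ t i j)) :=
    ae_all_iff.2 fun t => ae_all_iff.2 fun i => ae_all_iff.2 fun j =>
      strong_law_ae_of_hasLaw hlaw hindep (f := fun p => φ t p.1 i * φ t p.1 j)
        (by have := hφ t; fun_prop)
        ((memLp_feature hφ hφ2 t i).integrable_mul (memLp_feature hφ hφ2 t j))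
  filter_upwards [h1, h2, h3] with ω h1 h2 h3
  exact ⟨h1, fun t => tendsto_pi_nhds.2 fun j => h2 t j,
    fun t => tendsto_pi_nhds.2 fun i => tendsto_pi_nhds.2 fun j => h3 t i j⟩

/-- Adjugate over determinant: measurable everywhere, including at singular matrices. -/
theorem measurable_inv_apply {n : ℕ} (i j : Fin n) :
    Measurable fun A : Fin n → Fin n → ℝ => (Matrix.of A)⁻¹ i j := by
  have hof : Continuous fun A : Fin n → Fin n → ℝ => Matrix.of A := continuous_id
  simp only [Matrix.inv_def, Ring.inverse_eq_inv', Matrix.smul_apply, smul_eq_mul]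
  exact hof.matrix_det.measurable.inv.mul (hof.matrix_adjugate.matrix_elem i j).measurable

theorem measurable_excessRisk [Countable T] [MeasurableSpace T] [MeasurableSingletonClass T]
    (hφ : ∀ t, Measurable (φ t))
    (hφ2 : ∀ t j, Integrable (fun p : 𝒳 × ℝ => φ t p.1 j ^ 2) P)
    (hY2 : Integrable (fun p : 𝒳 × ℝ => p.2 ^ 2) P) :
    Measurable fun q : T × EuclideanSpace ℝ (Fin d) => excessRisk P φ q.1 q.2 := by
  refine measurable_from_prod_countable_right fun t => ?_
  have h : ∀ w : EuclideanSpace ℝ (Fin d), excessRisk P φ t w = risk P φ t 0 +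
      (fun j => ∫ p, (inner ℝ (0 : EuclideanSpace ℝ (Fin d)) (φ t p.1) - p.2) *
        φ t p.1 j ∂P) ⬝ᵥ w.ofLp + 1 / 2 * (w.ofLp ⬝ᵥ (covMat P φ t).mulVec w.ofLp)
      - optRisk P φ := fun w => by
    rw [excessRisk, ← risk_add hφ hφ2 hY2 t 0 w.ofLp]
    simp
  simp only [h, dotProduct]
  refine Continuous.measurable ?_
  fun_prop

/-- The map `a` selects coordinates: the identity gives the joint limit, and `j ↦ (t, j)` gives a
single block. A vector with the law of one block then need not be realized as a marginal of the
whole family. -/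
theorem tendstoInDistribution_whitenedSum_comp [IsProbabilityMeasure μ] [Fintype T] [DecidableEq T]
    (hφ : ∀ t, Measurable (φ t))
    (hsupp : ∀ t, ∀ v : EuclideanSpace ℝ (Fin d), v ≠ 0 → ¬ ∀ᵐ p ∂P, inner ℝ v (φ t p.1) = 0)
    (hφ2 : ∀ t j, Integrable (fun p : 𝒳 × ℝ => φ t p.1 j ^ 2) P)
    (hY2 : Integrable (fun p : 𝒳 × ℝ => p.2 ^ 2) P)
    (hg2 : ∀ t, Integrable (lossGradSqNorm P φ t) P)
    (hlaw : ∀ i, HasLaw (D i) P μ) (hindep : iIndepFun D μ)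
    {C : T → Matrix (Fin d) (Fin d) ℝ} (hCC : ∀ t, C t * C t = covMat P φ t)
    {ι : Type*} [Fintype ι] [DecidableEq ι] (a : ι → T × Fin d)
    {Ω' : Type*} [MeasurableSpace Ω'] {ν : Measure Ω'} [IsProbabilityMeasure ν]
    {Z : Ω' → EuclideanSpace ℝ ι}
    (hZ : HasLaw Z (multivariateGaussian 0 ((jointLimitCov P φ).submatrix a a)) ν)
    {g : EuclideanSpace ℝ ι × (T → Fin d → Fin d → ℝ) → ℝ} (hg : Continuous g) :
    TendstoInDistribution
      (fun (n : ℕ) ω => g (WithLp.toLp 2 fun k =>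
          whitenedSum P φ (fun i => D i ω) n (a k).1 (a k).2,
        fun t i j => (C t * (empCov φ (fun i => D i ω) n t)⁻¹ * C t) i j)) atTop
      (fun ω => g (Z ω, fun _ i j => (1 : Matrix (Fin d) (Fin d) ℝ) i j)) (fun _ => μ) ν := by
  have hclt : TendstoInDistribution
      (fun (n : ℕ) ω => (WithLp.toLp 2 fun k =>
          whitenedSum P φ (fun i => D i ω) n (a k).1 (a k).2 : EuclideanSpace ℝ ι)) atTop Z
      (fun _ => μ) ν := by
    set F : 𝒳 × ℝ → EuclideanSpace ℝ ι := fun p =>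
      WithLp.toLp 2 fun k => whitenedGrad P φ (a k).1 p (a k).2 with hF
    have hFm : Measurable F := by
      refine (PiLp.continuous_toLp 2 _).measurable.comp (measurable_pi_lambda _ fun k => ?_)
      exact measurable_whitenedGrad_apply hφ _ _
    have hFk : ∀ k, Measurable fun p => F p k := fun k => by fun_prop
    have h := tendstoInDistribution_inv_sqrt_smul_sum (X := fun i ω => F (D i ω)) (μ := μ) hZ
      (fun k => ?_) (fun k => ?_) (fun k l => ?_) (hindep.comp (fun _ => F) fun _ => hFm)
      (fun i => ((hlaw i).identDistrib (hlaw 0)).comp hFm)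
    · convert h using 3 with n ω
      ext k
      simp [whitenedSum, hF]
    · have : MemLp (fun p => F p k) 2 P := memLp_whitenedGrad hφ hsupp hφ2 hg2 (a k).1 (a k).2
      rw [← (hlaw 0).map_eq] at this
      have h' := (memLp_map_measure_iff (hFk k).aestronglyMeasurable (hlaw 0).aemeasurable).1 this
      exact h'
    · have := integral_whitenedGrad hφ hsupp hφ2 hY2 (a k).1 (a k).2
      have h' := integral_map (hlaw 0).aemeasurable (f := fun p => F p k)
        (hFk k).aestronglyMeasurable
      rw [(hlaw 0).map_eq] at h'
      exact h'.symm.trans this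
    · have := integral_whitenedGrad_mul hφ hsupp hφ2 hg2 (a k).1 (a l).1 (a k).2 (a l).2
      have h' := integral_map (hlaw 0).aemeasurable (f := fun p => F p k * F p l)
        ((hFk k).mul (hFk l)).aestronglyMeasurable
      rw [(hlaw 0).map_eq] at h'
      exact h'.symm.trans this
  have hmeas : ∀ n : ℕ, AEMeasurable (fun ω => (fun t i j =>
      (C t * (empCov φ (fun i => D i ω) n t)⁻¹ * C t) i j : T → Fin d → Fin d → ℝ)) μ := by
    intro n
    refine aemeasurable_pi_lambda _ fun t => ?_
    have hcov : AEMeasurable (fun ω => (fun i j => empCov φ (fun i => D i ω) n t i j :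
        Fin d → Fin d → ℝ)) μ := by
      refine aemeasurable_pi_lambda _ fun i => aemeasurable_pi_lambda _ fun j => ?_
      simp only [empCov, Matrix.of_apply]
      refine (Finset.aemeasurable_fun_sum _ fun k _ => ?_).const_mul _
      have hm : Measurable fun p : 𝒳 × ℝ => φ t p.1 i * φ t p.1 j := by
        have := hφ t
        fun_prop
      exact hm.comp_aemeasurable (hlaw k).aemeasurable
    refine aemeasurable_pi_lambda _ fun i => aemeasurable_pi_lambda _ fun j => ?_
    simp only [Matrix.mul_apply]
    refine Finset.aemeasurable_fun_sum _ fun k _ => AEMeasurable.mul_const ?_ _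
    refine Finset.aemeasurable_fun_sum _ fun l _ => AEMeasurable.const_mul ?_ _
    exact (measurable_inv_apply l k).comp_aemeasurable hcov
  -- Slutsky: the matrix component converges in measure to a constant.
  refine hclt.continuous_comp_prodMk_of_tendstoInMeasure_const hg ?_ hmeas
  refine tendstoInMeasure_of_tendsto_ae (fun n => (hmeas n).aestronglyMeasurable) ?_
  filter_upwards [ae_tendsto_empirical hφ hsupp hφ2 hY2 hlaw hindep] with ω hω
  refine tendsto_pi_nhds.2 fun t => ?_
  have hdet := isUnit_det_covMat hφ hsupp hφ2 t
  have h1 : C t * (covMat P φ t)⁻¹ * C t = 1 := by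
    have hC : IsUnit (C t).det := by
      rw [← hCC, Matrix.det_mul] at hdet
      exact isUnit_of_mul_isUnit_left hdet
    rw [← hCC, Matrix.mul_inv_rev, ← Matrix.mul_assoc, Matrix.mul_nonsing_inv _ hC, Matrix.one_mul,
      Matrix.nonsing_inv_mul _ hC]
  have h2 := ((tendsto_inv_empCov hdet (hω.2.2 t)).const_mul (C t)).mul_const (C t)
  rw [h1] at h2
  exact h2

end Sampling

/-! ### The excess risk of the empirical risk minimizer -/

section ExcessRisk

variable {T 𝒳 : Type*} [MeasurableSpace 𝒳] {d : ℕ}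
  {φ : T → 𝒳 → EuclideanSpace ℝ (Fin d)} {P : Measure (𝒳 × ℝ)}
  {Ω : Type*} [MeasurableSpace Ω] {μ : Measure Ω} {D : ℕ → Ω → 𝒳 × ℝ}

theorem ae_eventually_nat_mul_excessRisk_eq [Finite T] (hφ : ∀ t, Measurable (φ t))
    (hsupp : ∀ t, ∀ v : EuclideanSpace ℝ (Fin d), v ≠ 0 → ¬ ∀ᵐ p ∂P, inner ℝ v (φ t p.1) = 0)
    (hφ2 : ∀ t j, Integrable (fun p : 𝒳 × ℝ => φ t p.1 j ^ 2) P)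
    (hY2 : Integrable (fun p : 𝒳 × ℝ => p.2 ^ 2) P)
    (hlaw : ∀ i, HasLaw (D i) P μ) (hindep : iIndepFun D μ)
    {that : ℕ → Ω → T} {what : ℕ → Ω → EuclideanSpace ℝ (Fin d)}
    (herm : ∀ n, 1 ≤ n → ∀ᵐ ω ∂μ, ∀ t w,
      empRisk φ (fun i => D i ω) n (that n ω) (what n ω) ≤ empRisk φ (fun i => D i ω) n t w)
    {C : T → Matrix (Fin d) (Fin d) ℝ} (hC : ∀ t, (C t).IsHermitian)
    (hCC : ∀ t, C t * C t = covMat P φ t) (hCB : ∀ t, C t * covInvSqrt P φ t = 1) :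
    ∀ᵐ ω ∂μ, ∀ᶠ n : ℕ in atTop, that n ω ∈ tStar P φ ∧
      n * excessRisk P φ (that n ω) (what n ω) =
        1 / 2 * ∑ i, (C (that n ω) * (empCov φ (fun i => D i ω) n (that n ω))⁻¹ *
          C (that n ω)).mulVec (whitenedSum P φ (fun i => D i ω) n (that n ω)) i ^ 2 := by
  have herm' : ∀ᵐ ω ∂μ, ∀ n, 1 ≤ n → ∀ t w,
      empRisk φ (fun i => D i ω) n (that n ω) (what n ω) ≤ empRisk φ (fun i => D i ω) n t w :=
    ae_all_iff.2 fun n => ae_all_iff.2 (herm n)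
  filter_upwards [herm', ae_tendsto_empirical hφ hsupp hφ2 hY2 hlaw hindep] with ω h1 h2
  filter_upwards [eventually_mem_tStar_and_eq (that := fun n => that n ω)
    (what := fun n => what n ω) (isUnit_det_covMat hφ hsupp hφ2) h2.1 h2.2.1 h2.2.2 h1]
    with n hn
  refine ⟨hn.1, ?_⟩
  rw [hn.2, excessRisk_of_mem_tStar hφ hsupp hφ2 hY2 hn.1,
    ← nat_mul_empError_dotProduct (hC _) (hCC _) (hCB _)]
  ring

end ExcessRisk

/-! ### Continuity of finite extrema and of block norms -/

theorem continuous_ciSup_of_finite {X ι : Type*} [TopologicalSpace X] [Finite ι] [Nonempty ι]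
    {f : ι → X → ℝ} (hf : ∀ i, Continuous (f i)) : Continuous fun x => ⨆ i, f i x := by
  have := Fintype.ofFinite ι
  simp_rw [← Finset.sup'_univ_eq_ciSup]
  exact Continuous.finset_sup'_apply _ fun i _ => hf i

theorem continuous_ciInf_of_finite {X ι : Type*} [TopologicalSpace X] [Finite ι] [Nonempty ι]
    {f : ι → X → ℝ} (hf : ∀ i, Continuous (f i)) : Continuous fun x => ⨅ i, f i x := by
  have := Fintype.ofFinite ι
  simp_rw [← Finset.inf'_univ_eq_ciInf]
  exact Continuous.finset_inf'_apply _ fun i _ => hf i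

theorem measurable_comp₂ {Ω α β γ : Type*} [MeasurableSpace Ω] [MeasurableSpace α]
    [MeasurableSpace β] [MeasurableSpace γ] {f : α → β → γ}
    (hf : Measurable fun q : α × β => f q.1 q.2) {a : Ω → α} {b : Ω → β} (ha : Measurable a)
    (hb : Measurable b) : Measurable fun ω => f (a ω) (b ω) :=
  hf.comp (ha.prodMk hb)

theorem continuous_entry_mul_coord {T ι κ : Type*} (t : T) (i j : κ) (k : ι) :
    Continuous fun x : EuclideanSpace ℝ ι × (T → κ → κ → ℝ) => x.2 t i j * x.1 k := by
  have h1 : Continuous fun x : EuclideanSpace ℝ ι × (T → κ → κ → ℝ) => x.2 t i j :=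
    continuous_pi_iff.1 (continuous_pi_iff.1 (continuous_pi_iff.1 continuous_snd t) i) j
  exact h1.mul ((PiLp.continuous_apply 2 _ k).comp continuous_fst)

/-- The squared norm of the block `s` of the vector `x.1`, transformed by the matrix `x.2 s`. -/
noncomputable def blockNormSq {T : Type*} {d : ℕ} (s : T)
    (x : EuclideanSpace ℝ (T × Fin d) × (T → Fin d → Fin d → ℝ)) : ℝ :=
  ∑ i, (∑ j, x.2 s i j * x.1 (s, j)) ^ 2

theorem continuous_blockNormSq {T : Type*} {d : ℕ} (s : T) :
    Continuous (blockNormSq (d := d) s) :=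
  continuous_finsetSum _ fun i _ => (continuous_finsetSum _ fun j _ =>
    continuous_entry_mul_coord s i j (s, j)).pow 2

theorem blockNormSq_one {T : Type*} {d : ℕ} (s : T) (z : T → EuclideanSpace ℝ (Fin d)) :
    blockNormSq s (WithLp.toLp 2 fun a : T × Fin d => z a.1 a.2,
      fun _ i j => (1 : Matrix (Fin d) (Fin d) ℝ) i j) = ‖z s‖ ^ 2 := by
  simp [blockNormSq, Matrix.one_apply, EuclideanSpace.real_norm_sq_eq]

/-! ### The limit theorem -/

theorem corollary2
    {T : Type*} [Fintype T] [DecidableEq T] [MeasurableSpace T] [MeasurableSingletonClass T]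
    {𝒳 : Type*} [MeasurableSpace 𝒳] {d : ℕ}
    -- the feature maps and the law of `(X, Y)`
    (φ : T → 𝒳 → EuclideanSpace ℝ (Fin d)) (hφ : ∀ t, Measurable (φ t))
    (P : Measure (𝒳 × ℝ)) [IsProbabilityMeasure P]
    -- no `φ_t(X)` is supported in a hyperplane through the origin
    (hsupp : ∀ t, ∀ v : EuclideanSpace ℝ (Fin d), v ≠ 0 → ¬ ∀ᵐ p ∂P, inner ℝ v (φ t p.1) = 0)
    -- moment assumptions
    (hφ2 : ∀ t j, Integrable (fun p : 𝒳 × ℝ => φ t p.1 j ^ 2) P)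
    (hY2 : Integrable (fun p : 𝒳 × ℝ => p.2 ^ 2) P)
    (hg2 : ∀ t, Integrable (lossGradSqNorm P φ t) P)
    -- i.i.d. samples `D i = (X_i, Y_i)` of `P`
    {Ω : Type*} [MeasurableSpace Ω] (μ : Measure Ω) [IsProbabilityMeasure μ]
    (D : ℕ → Ω → 𝒳 × ℝ) (hlaw : ∀ i, HasLaw (D i) P μ) (hindep : iIndepFun D μ)
    -- a sequence of empirical risk minimizers
    (that : ℕ → Ω → T) (what : ℕ → Ω → EuclideanSpace ℝ (Fin d))
    (hthat : ∀ n, Measurable (that n)) (hwhat : ∀ n, Measurable (what n))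
    (herm : ∀ n, 1 ≤ n → ∀ᵐ ω ∂μ, ∀ t w,
      empRisk φ (fun i => D i ω) n (that n ω) (what n ω) ≤ empRisk φ (fun i => D i ω) n t w) :
    Tendsto (fun n => μ {ω | that n ω ∉ tStar P φ}) atTop (𝓝 0) ∧
    (∀ {Ω' : Type*} [MeasurableSpace Ω'] (ν : Measure Ω') [IsProbabilityMeasure ν]
      (Z : T → Ω' → EuclideanSpace ℝ (Fin d)),
      HasLaw (fun ω => WithLp.toLp 2 fun a : T × Fin d => Z a.1 ω a.2)
        (multivariateGaussian 0 (jointLimitCov P φ)) ν →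
      ∀ δ ∈ Set.Ioo (0 : ℝ) 1,
        ((1 / 2 * quantile ν (fun ω => ⨅ s : tStar P φ, ‖Z s ω‖ ^ 2) (1 - δ) : ℝ) : EReal) ≤
          liminf (fun n : ℕ => ((n * quantile μ
            (fun ω => excessRisk P φ (that n ω) (what n ω)) (1 - δ) : ℝ) : EReal)) atTop ∧
        liminf (fun n : ℕ => ((n * quantile μ
            (fun ω => excessRisk P φ (that n ω) (what n ω)) (1 - δ) : ℝ) : EReal)) atTop ≤
          limsup (fun n : ℕ => ((n * quantile μ
            (fun ω => excessRisk P φ (that n ω) (what n ω)) (1 - δ) : ℝ) : EReal)) atTop ∧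
        limsup (fun n : ℕ => ((n * quantile μ
            (fun ω => excessRisk P φ (that n ω) (what n ω)) (1 - δ) : ℝ) : EReal)) atTop ≤
          ((1 / 2 * quantile ν (fun ω => ⨆ s : tStar P φ, ‖Z s ω‖ ^ 2) (1 - δ) : ℝ) : EReal)) ∧
    (∀ tstar : T, tStar P φ = {tstar} →
      ∀ {Ω' : Type*} [MeasurableSpace Ω'] (ν : Measure Ω') [IsProbabilityMeasure ν]
        (Z : Ω' → EuclideanSpace ℝ (Fin d)),
        HasLaw Z (multivariateGaussian 0 (limitCov P φ tstar tstar)) ν →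
        TendstoInDistribution
          (fun (n : ℕ) ω => n * excessRisk P φ (that n ω) (what n ω)) atTop
          (fun ω' => 1 / 2 * ‖Z ω'‖ ^ 2) (fun _ => μ) ν) := by
  classical
  choose C hC hCC hCB using fun t => exists_sqrt_covMat (P := P) hφ hsupp hφ2 t
  have hEq := ae_eventually_nat_mul_excessRisk_eq hφ hsupp hφ2 hY2 hlaw hindep herm hC hCC hCB
  have hEm : ∀ n : ℕ, Measurable fun ω => excessRisk P φ (that n ω) (what n ω) := fun n =>
    measurable_comp₂ (measurable_excessRisk hφ hφ2 hY2) (hthat n) (hwhat n)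
  have hnEm : ∀ n : ℕ, AEMeasurable (fun ω => n * excessRisk P φ (that n ω) (what n ω)) μ :=
    fun n => ((hEm n).const_mul _).aemeasurable
  refine ⟨?_, ?_, ?_⟩
  · refine tendsto_measure_compl_of_ae_eventually_mem (s := fun n => {ω | that n ω ∈ tStar P φ})
      (fun n => ?_) ?_
    · exact (hthat n (Set.toFinite _).measurableSet).nullMeasurableSet
    · filter_upwards [hEq] with ω hω
      filter_upwards [hω] with n hn using hn.1
  · intro Ω' _ ν _ Z hZ δ hδ
    have hp0 : 0 < 1 - δ := by linarith [hδ.2]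
    have hp1 : 1 - δ < 1 := by linarith [hδ.1]
    obtain ⟨ω₀⟩ : Nonempty Ω := μ.nonempty_of_neZero
    have : Nonempty T := ⟨that 0 ω₀⟩
    have : Nonempty (tStar P φ) := (tStar_nonempty (P := P) (φ := φ)).to_subtype
    have hZ' : HasLaw (fun ω => WithLp.toLp 2 fun a : T × Fin d => Z a.1 ω a.2)
        (multivariateGaussian 0 ((jointLimitCov P φ).submatrix id id)) ν := by
      rwa [Matrix.submatrix_id_id]
    obtain ⟨x, hx⟩ : ∃ x : ℕ → Ω → EuclideanSpace ℝ (T × Fin d) × (T → Fin d → Fin d → ℝ),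
        x = fun n ω => (WithLp.toLp 2 fun k => whitenedSum P φ (fun i => D i ω) n k.1 k.2,
          fun t i j => (C t * (empCov φ (fun i => D i ω) n t)⁻¹ * C t) i j) := ⟨_, rfl⟩
    have hEx : ∀ᵐ ω ∂μ, ∀ᶠ n : ℕ in atTop, that n ω ∈ tStar P φ ∧
        n * excessRisk P φ (that n ω) (what n ω) = 1 / 2 * blockNormSq (that n ω) (x n ω) := by
      filter_upwards [hEq] with ω hω
      filter_upwards [hω] with n hn
      refine ⟨hn.1, ?_⟩
      rw [hn.2, hx]
      simp [blockNormSq, Matrix.mulVec, dotProduct]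
    have hinf := tendstoInDistribution_whitenedSum_comp hφ hsupp hφ2 hY2 hg2 hlaw hindep hCC id hZ'
      (g := fun x => 1 / 2 * ⨅ s : tStar P φ, blockNormSq (s : T) x)
      (continuous_const.mul (continuous_ciInf_of_finite fun s => continuous_blockNormSq (s : T)))
    have hsup := tendstoInDistribution_whitenedSum_comp hφ hsupp hφ2 hY2 hg2 hlaw hindep hCC id hZ'
      (g := fun x => 1 / 2 * ⨆ s : tStar P φ, blockNormSq (s : T) x)
      (continuous_const.mul (continuous_ciSup_of_finite fun s => continuous_blockNormSq (s : T)))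
    have hqZ : ∀ s ω, blockNormSq s (WithLp.toLp 2 fun a : T × Fin d => Z a.1 ω a.2,
        fun _ i j => (1 : Matrix (Fin d) (Fin d) ℝ) i j) = ‖Z s ω‖ ^ 2 := fun s ω =>
      blockNormSq_one s fun s => Z s ω
    simp only [hqZ] at hinf hsup
    replace hinf : TendstoInDistribution
        (fun n ω => 1 / 2 * ⨅ s : tStar P φ, blockNormSq (s : T) (x n ω)) atTop
        (fun ω => 1 / 2 * ⨅ s : tStar P φ, ‖Z s ω‖ ^ 2) (fun _ => μ) ν := by
      rw [hx]
      exact hinf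
    replace hsup : TendstoInDistribution
        (fun n ω => 1 / 2 * ⨆ s : tStar P φ, blockNormSq (s : T) (x n ω)) atTop
        (fun ω => 1 / 2 * ⨆ s : tStar P φ, ‖Z s ω‖ ^ 2) (fun _ => μ) ν := by
      rw [hx]
      exact hsup
    -- The factor `n` enters the quantile only when positive, hence from `n = 1` on.
    have hscale : ∀ᶠ n : ℕ in atTop,
        ((quantile μ (fun ω => n * excessRisk P φ (that n ω) (what n ω)) (1 - δ) : ℝ) : EReal) =
        ((n * quantile μ (fun ω => excessRisk P φ (that n ω) (what n ω)) (1 - δ) : ℝ) : EReal) := by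
      filter_upwards [eventually_ge_atTop 1] with n hn
      rw [quantile_const_mul _ _ _ (Nat.cast_pos.2 hn)]
    rw [← liminf_congr hscale, ← limsup_congr hscale,
      ← quantile_const_mul _ _ _ (one_half_pos (α := ℝ)),
      ← quantile_const_mul _ _ _ (one_half_pos (α := ℝ))]
    refine ⟨?_, liminf_le_limsup, ?_⟩
    · refine quantile_le_liminf_quantile hinf hnEm ?_ hp0 hp1
      filter_upwards [hEx] with ω hω
      filter_upwards [hω] with n hn
      rw [hn.2]
      refine mul_le_mul_of_nonneg_left ?_ one_half_pos.le
      exact ciInf_le (f := fun s : tStar P φ => blockNormSq (s : T) (x n ω))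
        (Set.finite_range _).bddBelow ⟨that n ω, hn.1⟩
    · refine limsup_quantile_le_quantile hsup hnEm ?_ hp0 fun y hy => ?_
      · filter_upwards [hEx] with ω hω
        filter_upwards [hω] with n hn
        rw [hn.2]
        refine mul_le_mul_of_nonneg_left ?_ one_half_pos.le
        exact le_ciSup (f := fun s : tStar P φ => blockNormSq (s : T) (x n ω))
          (Set.finite_range _).bddAbove ⟨that n ω, hn.1⟩
      -- Half the maximum, written as a function of the whole Gaussian vector, to which the
      -- homogeneity lemma applies.
      · set h : EuclideanSpace ℝ (T × Fin d) → ℝ := fun z =>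
          1 / 2 * ⨆ s : tStar P φ, ∑ i, z ((s : T), i) ^ 2 with hh
        have hhZ : ∀ ω, 1 / 2 * ⨆ s : tStar P φ, ‖Z s ω‖ ^ 2 =
            h (WithLp.toLp 2 fun a : T × Fin d => Z a.1 ω a.2) := fun ω => by
          simp [hh, EuclideanSpace.real_norm_sq_eq]
        simp only [hhZ] at hy ⊢
        refine lt_measureReal_lt_of_quantile_lt_of_homogeneous hZ (h := h) ?_ (fun z => ?_)
          (fun c z => ?_) hp0 hp1 hy
        · exact continuous_const.mul (continuous_ciSup_of_finite fun s =>
            continuous_finsetSum _ fun i _ => (PiLp.continuous_apply 2 _ _).pow 2)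
        · exact mul_nonneg one_half_pos.le
            (Real.iSup_nonneg fun s => Finset.sum_nonneg fun _ _ => sq_nonneg _)
        · simp only [hh, PiLp.smul_apply, smul_eq_mul, mul_pow, ← Finset.mul_sum]
          rw [← Real.mul_iSup_of_nonneg (sq_nonneg c)]
          ring
  · intro t ht Ω' _ ν _ Z hZ
    have hlim := tendstoInDistribution_whitenedSum_comp hφ hsupp hφ2 hY2 hg2 hlaw hindep hCC
      (fun j => (t, j)) (Z := Z) (ν := ν) hZ
      (g := fun x => 1 / 2 * ∑ i, (∑ j, x.2 t i j * x.1 j) ^ 2)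
      (continuous_const.mul (continuous_finsetSum _ fun i _ => (continuous_finsetSum _ fun j _ =>
        continuous_entry_mul_coord t i j j).pow 2))
    have hlimZ : ∀ ω, ∑ i, (∑ j, (1 : Matrix (Fin d) (Fin d) ℝ) i j * Z ω j) ^ 2 = ‖Z ω‖ ^ 2 :=
      fun ω => by simp [Matrix.one_apply, EuclideanSpace.real_norm_sq_eq]
    simp only [hlimZ] at hlim
    -- With a single optimal `t`, the difference from the convergent sequence is almost surely
    -- eventually 0.
    refine tendstoInDistribution_of_tendstoInMeasure_sub _ _ hlim ?_ hnEm
    refine tendstoInMeasure_of_tendsto_ae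
      (fun n => ((hnEm n).sub (hlim.forall_aemeasurable n)).aestronglyMeasurable) ?_
    filter_upwards [hEq] with ω hω
    refine tendsto_const_nhds.congr' ?_
    filter_upwards [hω] with n hn
    have htn : that n ω = t := by simpa [ht] using hn.1
    simp only [Pi.sub_apply, Pi.zero_apply]
    rw [hn.2, htn]
    simp [Matrix.mulVec, dotProduct]
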